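/- Let $X_1,\dots,X_n$ ($n\ge 2$) be a random sample from the Gamma distribution with density $\lambda^\alpha x^{\alpha-1}e^{-\lambda x}/\Gamma(\alpha)$, $x>0$, where both $\alpha>0$ and $\lambda>0$ are unknown. Put $X=\sum_{i=1}^n X_i$, $\overline X=X/n$, and $Y=\overline X^{-n}\prod_{i=1}^n X_i$ (so $Y^{1/n}$ is the ratio of the geometric to the arithmetic mean). Define $\gamma_1(0)=1$, $\gamma_1(m)=0$ for $m\ge1$, and, for $1\le i\le n-2$ and $m\ge0$, $$\gamma_{i+1}(m)=\frac{\Gamma\big(m+\frac{i(i+1)}{2n}\big)}{\Gamma\big(m+\frac{(i+1)(i+2)}{2n}\big)}\sum_{k=0}^m\frac{\Gamma\big(m-k+\frac{i+1}{n}\big)}{(m-k)!}\,\gamma_i(k),$$ let $d_m=\gamma_{n-1}(m)$ and $G(y)=\sum_{m\ge0}d_m(1-y)^m$. An estimator is called the UMVUE of $h(\alpha,\lambda)$ if it is (almost surely) a Borel function of the statistic $(X,Y)$, this statistic being complete and sufficient, if it is integrable with expectation $h(\alpha,\lambda)$ for all $\alpha,\lambda>0$, and if for all $\alpha,\lambda>0$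 its variance (possibly infinite) is at most that of every unbiased estimator of $h(\alpha,\lambda)$. **Theorem.** (i) Let $n\ge2$. For $0<y<1$ the series $G(y)$ converges, $G(y)>0$, and $x\mapsto x^{-1}(1-x)^{(n-3)/2}G(x)$ is integrable on $(y,1)$. The UMVUE of $1/\alpha$ is $u_2(Y)$, where $$u_2(y)=\frac{(1-y)^{-(n-3)/2}}{G(y)}\int_y^1\frac1x(1-x)^{(n-3)/2}G(x)\,dx,$$ and the UMVUE of $1/\lambda$ is $u_3(X,Y)=\overline X\,u_2(Y)$. (ii) For $n=2$ one has $u_2(y)=\sqrt{1-y}\,\big(2\log(1+\sqrt{1-y})-\log y\big)$ for $0<y\le1$ (with $u_2(1)=0$), and for all positive $X_1,X_2$ $$u_2(Y)=T_2(X_1,X_2):=\frac{(X_2-X_1)(\log X_2-\log X_1)}{X_1+X_2},\qquad u_3(X,Y)=T_3(X_1,X_2):=\tfrac12(X_2-X_1)(\log X_2-\log X_1).$$ (iii) For every $n\ge2$ and positive $X_1,\dots,X_n$, the $U$-statistic with kernel $T_3$ is the Ye–Chen estimator of $1/\lambda$, $$\frac{2}{n(n-1)}\sum_{i<j}T_3(X_i,X_j)=\widehat{\lambda^{-1}}(n):=\frac1{n-1}\Big\{\sum_{i=1}^nX_i\log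 X_i-\overline X\sum_{i=1}^n\log X_i\Big\},$$ and, divided by $\overline X$, it is the Ye–Chen estimator of $1/\alpha$, $\widehat{\alpha^{-1}}(n):=\widehat{\lambda^{-1}}(n)/\overline X$, which for $n=2$ equals $u_2(Y)$. The $U$-statistics with kernels $T_3$ and $T_2$ are unbiased estimators of $1/\lambda$ and of $1/\alpha$, respectively, for all $\alpha,\lambda>0$. -/

import Mathlib

open MeasureTheory ProbabilityTheory

noncomputable section

/-! ### Unbiased estimation in a statistical model

A statistical model is a family `P : Θ → Measure Ω` of laws on the sample space `Ω`;
an estimator is a real function on `Ω`. -/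

/-- `T` is an unbiased estimator of the parametric function `h`: under every parameter it is
integrable with expectation `h θ`. -/
def IsUnbiasedEstimator {Θ Ω : Type*} [MeasurableSpace Ω] (P : Θ → Measure Ω) (h : Θ → ℝ)
    (T : Ω → ℝ) : Prop :=
  ∀ θ, Integrable T (P θ) ∧ ∫ ω, T ω ∂(P θ) = h θ

/-- The statistic `S` is sufficient: the conditional probability of every event given `S` has a
version that does not depend on the parameter. -/
def IsSufficientStatistic {Θ Ω β : Type*} [MeasurableSpace Ω] [mβ : MeasurableSpace β]
    (P : Θ → Measure Ω) (S : Ω → β) : Prop :=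
  Measurable S ∧ ∀ A : Set Ω, MeasurableSet A →
    ∃ κ : β → ℝ, Measurable κ ∧
      ∀ θ, (P θ)[A.indicator (fun _ => (1 : ℝ)) | mβ.comap S] =ᵐ[P θ] fun ω => κ (S ω)

/-- The statistic `S` is complete: the only Borel function of `S` that is an unbiased estimator of
zero is zero, up to null sets. -/
def IsCompleteStatistic {Θ Ω β : Type*} [MeasurableSpace Ω] [MeasurableSpace β]
    (P : Θ → Measure Ω) (S : Ω → β) : Prop :=
  ∀ g : β → ℝ, Measurable g → IsUnbiasedEstimator P (fun _ => 0) (fun ω => g (S ω)) →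
    ∀ θ, (fun ω => g (S ω)) =ᵐ[P θ] fun _ => 0

/-- `T` is the uniformly minimum variance unbiased estimator of `h`, based on the statistic `S`:
`S` is complete and sufficient, `T` is an unbiased estimator of `h`, it is almost surely a Borel
function of `S`, and at every parameter its variance (which may be infinite) is at most that of
any unbiased estimator of `h`. -/
structure IsUMVUE {Θ Ω β : Type*} [MeasurableSpace Ω] [MeasurableSpace β]
    (P : Θ → Measure Ω) (S : Ω → β) (h : Θ → ℝ) (T : Ω → ℝ) : Prop where
  sufficient : IsSufficientStatistic P S
  complete : IsCompleteStatistic P S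
  factors : ∃ u : β → ℝ, Measurable u ∧ ∀ θ, T =ᵐ[P θ] fun ω => u (S ω)
  unbiased : IsUnbiasedEstimator P h T
  minVariance : ∀ T' : Ω → ℝ, IsUnbiasedEstimator P h T' →
    ∀ θ, evariance T (P θ) ≤ evariance T' (P θ)

/-! ### The two-parameter gamma model -/

/-- The parameters of a gamma distribution: shape `α > 0` and rate (reciprocal scale) `λ > 0`. -/
structure GammaParam where
  shape : ℝ
  rate : ℝ
  shape_pos : 0 < shape
  rate_pos : 0 < rate

/-- The law of a random sample of size `n` from the gamma distribution with parameter `θ`. -/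
def gammaSample (n : ℕ) (θ : GammaParam) : Measure (Fin n → ℝ) :=
  Measure.pi fun _ => gammaMeasure θ.shape θ.rate

/-- The sum `X` of the observations. -/
def sampleSum {n : ℕ} (x : Fin n → ℝ) : ℝ := ∑ i, x i

/-- The arithmetic mean of the observations. -/
def sampleMean {n : ℕ} (x : Fin n → ℝ) : ℝ := sampleSum x / n

/-- The statistic `Y`: the `n`-th power of the ratio of the geometric mean to the arithmetic mean
of the observations. -/
def meanRatio {n : ℕ} (x : Fin n → ℝ) : ℝ := (∏ i, x i) / sampleMean x ^ n

/-- The statistic `(X, Y)`. -/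
def gammaStatistic {n : ℕ} (x : Fin n → ℝ) : ℝ × ℝ := (sampleSum x, meanRatio x)

/-! ### The function `G` and the estimators -/

/-- `glaserCoeff n j m` is the coefficient `γ_{j+1}(m)`, where `γ_1(m)` is `1` for `m = 0` and `0`
otherwise, and, for `i ≥ 1`,
`γ_{i+1}(m) = Γ(m + i(i+1)/(2n)) / Γ(m + (i+1)(i+2)/(2n))
    * ∑_{k=0}^m Γ(m - k + (i+1)/n) / (m-k)! * γ_i(k)`. -/
def glaserCoeff (n : ℕ) : ℕ → ℕ → ℝ
  | 0, m => if m = 0 then 1 else 0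
  | j + 1, m =>
    Real.Gamma (m + ((j : ℝ) + 1) * (j + 2) / (2 * n)) /
        Real.Gamma (m + ((j : ℝ) + 2) * (j + 3) / (2 * n)) *
      ∑ k ∈ Finset.range (m + 1),
        Real.Gamma (((m - k : ℕ) : ℝ) + ((j : ℝ) + 2) / n) / ((m - k).factorial : ℝ) *
          glaserCoeff n j k

/-- The coefficient `d_m = γ_{n-1}(m)`, for `n ≥ 2`. -/
def glaserD (n m : ℕ) : ℝ := glaserCoeff n (n - 2) m

/-- The power series `G(y) = ∑ d_m (1 - y)^m`. -/
def glaserG (n : ℕ) (y : ℝ) : ℝ := ∑' m, glaserD n m * (1 - y) ^ m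

/-- The function `u₂`. -/
def u2 (n : ℕ) (y : ℝ) : ℝ :=
  (1 - y) ^ (-((n : ℝ) - 3) / 2) / glaserG n y *
    ∫ x in y..1, x⁻¹ * (1 - x) ^ (((n : ℝ) - 3) / 2) * glaserG n x

/-- The estimator `u₂(Y)`. -/
def shapeInvEstimator {n : ℕ} (x : Fin n → ℝ) : ℝ := u2 n (meanRatio x)

/-- The estimator `u₃(X, Y)`, the sample mean times `u₂(Y)`. -/
def rateInvEstimator {n : ℕ} (x : Fin n → ℝ) : ℝ := sampleMean x * u2 n (meanRatio x)

/-! ### Closed forms and the Ye–Chen estimators -/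

/-- The symmetric kernel `T₂`. -/
def kernelT2 (a b : ℝ) : ℝ := (b - a) * (Real.log b - Real.log a) / (a + b)

/-- The symmetric kernel `T₃`. -/
def kernelT3 (a b : ℝ) : ℝ := 1 / 2 * (b - a) * (Real.log b - Real.log a)

/-- The `U`-statistic generated by the symmetric kernel `k` of two observations. -/
def uStatistic (k : ℝ → ℝ → ℝ) {n : ℕ} (x : Fin n → ℝ) : ℝ :=
  2 / ((n : ℝ) * (n - 1)) * ∑ i, ∑ j ∈ Finset.Ioi i, k (x i) (x j)

/-- The Ye–Chen estimator of `1/λ`. -/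
def yeChenRateInv {n : ℕ} (x : Fin n → ℝ) : ℝ :=
  1 / ((n : ℝ) - 1) * (∑ i, x i * Real.log (x i) - sampleMean x * ∑ i, Real.log (x i))

/-- The Ye–Chen estimator of `1/α`. -/
def yeChenShapeInv {n : ℕ} (x : Fin n → ℝ) : ℝ :=
  1 / ((n : ℝ) - 1) *
    ((∑ i, x i * Real.log (x i) - sampleMean x * ∑ i, Real.log (x i)) / sampleMean x)

end

/-! Relative to the law with `α = λ = 1`, the likelihood of a sample is a constant times `(∏
xᵢ)^(α-1) e^{-(λ-1)∑ xᵢ}`, hence a function of `(X, Y)`; this gives sufficiency. In the bounded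
coordinates `(e^{-X}, e^{-X} ∏ Xᵢ)` these likelihoods contain, up to constants, all monomials, so a
function of `(X, Y)` with mean zero at all parameters has vanishing moments and is null
(`isCompleteStatistic_gammaStatistic`). By Lehmann–Scheffé only unbiasedness remains to be proved.

The law of `(X, Y)` is found by comparing moments (`map_gammaStatistic`): `X` is gamma with shape
`nα`, and `Y` is independent of it with density proportional to `y^(α-1) w(y)`, where `w(y) =
(1-y)^((n-3)/2) G(y)`. The Mellin transform of `w` is a product of beta functions `B(s, k/n)`, `1 ≤
k ≤ n-1`: the recursion for `γ` is Gauss's summation formula, each step contributing one more beta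
factor (`tsum_glaserCoeff`). Agreement with the moments of the sample is the multiplication formula
for Gamma, needed only for integral shifts (`glaserMellin_add_natCast`).

Since `w(y) u₂(y) = ∫_y^1 w(x)/x dx`, exchanging the order of integration and using `∫_0^x y^(α-1)
dy = x^α/α` gives `E u₂(Y) = 1/α` (`lintegral_u2_ratioMeasure`); independence and `E X̄ = α/λ`
handle `u₃`. For `n = 2` one has `G = 1`, the integral is elementary, and `1 - Y` is the square of
`(X₂-X₁)/(X₁+X₂)`. Any two observations form a sample of size two, so the `U`-statistics inherit
unbiasedness by linearity. -/

/-! ### Rao–Blackwell and Lehmann–Scheffé -/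

section LehmannScheffe

variable {Θ Ω β : Type*} [MeasurableSpace Ω] [mβ : MeasurableSpace β] {P : Θ → Measure Ω}
  {S : Ω → β}

/-- Every law of the family has a density with respect to the law `P θ₀` that is a function of
the statistic `S`. -/
def HasFactoredDensity {Θ Ω β : Type*} [MeasurableSpace Ω] [MeasurableSpace β]
    (P : Θ → Measure Ω) (S : Ω → β) (θ₀ : Θ) : Prop :=
  ∀ θ, ∃ f : β → NNReal, Measurable f ∧ P θ = (P θ₀).withDensity fun ω => (f (S ω) : ENNReal)

/-- Under a factored density, the conditional expectation given `S` of a variable that is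
integrable under all parameters has a version that does not depend on the parameter. -/
theorem HasFactoredDensity.exists_condExp_eq_comp [∀ θ, IsProbabilityMeasure (P θ)] {θ₀ : Θ}
    (hP : HasFactoredDensity P S θ₀) (hS : Measurable S) {T : Ω → ℝ}
    (hT : ∀ θ, Integrable T (P θ)) :
    ∃ κ : β → ℝ, Measurable κ ∧
      ∀ θ, (P θ)[T | mβ.comap S] =ᵐ[P θ] fun ω => κ (S ω) := by
  obtain ⟨κ, hκ, hκS⟩ := (stronglyMeasurable_condExp (μ := P θ₀) (m := mβ.comap S)
    (f := T)).exists_eq_measurable_comp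
  refine ⟨κ, hκ.measurable, fun θ => ?_⟩
  obtain ⟨f, hf, hfP⟩ := hP θ
  have hm : mβ.comap S ≤ ‹MeasurableSpace Ω› := hS.comap_le
  have hfS : Measurable fun ω => f (S ω) := hf.comp hS
  have hfSm : StronglyMeasurable[mβ.comap S] fun ω => (f (S ω) : ℝ) :=
    ((NNReal.continuous_coe.measurable.comp hf).comp (comap_measurable S)).stronglyMeasurable
  have hTθ := hT θ
  rw [hfP, integrable_withDensity_iff_integrable_smul hfS] at hTθ
  have hTθ' : Integrable ((fun ω => (f (S ω) : ℝ)) * T) (P θ₀) := hTθ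
  -- The density is measurable with respect to `S`, so it pulls out of the conditional expectation
  -- under `θ₀`. This is why the version computed under `θ₀` also serves under `θ`.
  have hpull := condExp_mul_of_stronglyMeasurable_left hfSm hTθ' (hT θ₀)
  rw [hκS] at hpull
  have hint : Integrable ((fun ω => (f (S ω) : ℝ)) * (κ ∘ S)) (P θ₀) :=
    integrable_condExp.congr hpull
  have hκint : Integrable (fun ω => κ (S ω)) (P θ) := by
    rw [hfP, integrable_withDensity_iff_integrable_smul hfS]
    exact hint
  refine (ae_eq_condExp_of_forall_setIntegral_eq hm (hT θ) (fun _ _ _ => hκint.integrableOn)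
    (fun s hs _ => ?_) ?_).symm
  · rw [hfP, restrict_withDensity (hm s hs), integral_withDensity_eq_integral_smul hfS,
      integral_withDensity_eq_integral_smul hfS]
    calc ∫ ω in s, f (S ω) • κ (S ω) ∂(P θ₀)
        = ∫ ω in s, ((P θ₀)[(fun ω => (f (S ω) : ℝ)) * T | mβ.comap S]) ω ∂(P θ₀) :=
          integral_congr_ae (ae_restrict_of_ae hpull.symm)
      _ = ∫ ω in s, f (S ω) • T ω ∂(P θ₀) := setIntegral_condExp hm hTθ' hs
  · exact (hκ.measurable.comp (comap_measurable S)).stronglyMeasurable.aestronglyMeasurable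

/-- The factorization criterion for sufficiency. -/
theorem HasFactoredDensity.isSufficientStatistic [∀ θ, IsProbabilityMeasure (P θ)] {θ₀ : Θ}
    (hP : HasFactoredDensity P S θ₀) (hS : Measurable S) : IsSufficientStatistic P S :=
  ⟨hS, fun _ hA => hP.exists_condExp_eq_comp hS fun _ => (integrable_const _).indicator hA⟩

/-- Conditioning does not increase the variance. -/
theorem evariance_condExp_le {Ω : Type*} {m mΩ : MeasurableSpace Ω} {μ : Measure Ω}
    [IsProbabilityMeasure μ] (hm : m ≤ mΩ) {T : Ω → ℝ} (hT : Integrable T μ) :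
    evariance (μ[T | m]) μ ≤ evariance T μ := by
  -- For square-integrable `T` this is the law of total variance. Otherwise the right side is
  -- infinite.
  by_cases h2 : MemLp T 2 μ
  · rw [← h2.ofReal_variance_eq, ← (h2.condExp one_le_two).ofReal_variance_eq]
    refine ENNReal.ofReal_le_ofReal ?_
    rw [← integral_condVar_add_variance_condExp hm h2]
    refine le_add_of_nonneg_left (integral_nonneg_of_ae ?_)
    exact condExp_nonneg (ae_of_all _ fun ω => sq_nonneg _)
  · rw [evariance_eq_top hT.1 h2]
    exact le_top

/-- **Lehmann–Scheffé theorem**: an unbiased estimator that is a function of a complete sufficient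
statistic is the UMVUE of its expectation. -/
theorem HasFactoredDensity.isUMVUE [∀ θ, IsProbabilityMeasure (P θ)] {θ₀ : Θ}
    (hP : HasFactoredDensity P S θ₀) (hS : Measurable S) (hc : IsCompleteStatistic P S)
    {h : Θ → ℝ} {T : Ω → ℝ} (hT : IsUnbiasedEstimator P h T) {u : β → ℝ} (hu : Measurable u)
    (hTu : ∀ θ, T =ᵐ[P θ] fun ω => u (S ω)) : IsUMVUE P S h T where
  sufficient := hP.isSufficientStatistic hS
  complete := hc
  factors := ⟨u, hu, hTu⟩
  unbiased := hT
  minVariance T' hT' θ := by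
    obtain ⟨κ, hκ, hκT⟩ := hP.exists_condExp_eq_comp hS fun θ => (hT' θ).1
    have huint : ∀ θ, Integrable (fun ω => u (S ω)) (P θ) := fun θ => (hT θ).1.congr (hTu θ)
    have hκint : ∀ θ, Integrable (fun ω => κ (S ω)) (P θ) :=
      fun θ => integrable_condExp.congr (hκT θ)
    -- Both `u(S)` and `κ(S) = E[T' | S]` are unbiased for `h`, so completeness identifies them:
    -- conditioning any competitor on `S` yields `T`.
    have hzero := hc (fun s => u s - κ s) (hu.sub hκ) (fun θ =>
      ⟨(huint θ).sub (hκint θ), by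
        rw [integral_sub (huint θ) (hκint θ), ← integral_congr_ae (hTu θ),
          ← integral_congr_ae (hκT θ), integral_condExp hS.comap_le, (hT θ).2, (hT' θ).2,
          sub_self]⟩) θ
    have heq : T =ᵐ[P θ] (P θ)[T' | mβ.comap S] := by
      filter_upwards [hTu θ, hκT θ, hzero] with ω h1 h2 h3
      rw [h1, h2]
      exact sub_eq_zero.1 h3
    rw [evariance_congr heq]
    exact evariance_condExp_le hS.comap_le (hT' θ).1

end LehmannScheffe

/-! ### Measures on the unit square are determined by their moments -/

/-- The closed unit square, as a product of subtypes. -/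
abbrev UnitSquare : Type := Set.Icc (0 : ℝ) 1 × Set.Icc (0 : ℝ) 1

/-- A finite measure on the unit square is determined by its moments. -/
theorem MeasureTheory.Measure.ext_of_moments_unitSquare {μ ν : Measure (ℝ × ℝ)}
    [IsFiniteMeasure μ] [IsFiniteMeasure ν]
    (hμ : ∀ᵐ p ∂μ, p.1 ∈ Set.Icc (0 : ℝ) 1 ∧ p.2 ∈ Set.Icc (0 : ℝ) 1)
    (hν : ∀ᵐ p ∂ν, p.1 ∈ Set.Icc (0 : ℝ) 1 ∧ p.2 ∈ Set.Icc (0 : ℝ) 1)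
    (h : ∀ j k : ℕ, ∫ p, p.1 ^ j * p.2 ^ k ∂μ = ∫ p, p.1 ^ j * p.2 ^ k ∂ν) : μ = ν := by
  -- Retract to the compact square, where all continuous functions are bounded. On the support `c`
  -- inverts `r`, so nothing is lost.
  let r : ℝ × ℝ → UnitSquare := fun p =>
    (Set.projIcc 0 1 zero_le_one p.1, Set.projIcc 0 1 zero_le_one p.2)
  let c : UnitSquare → ℝ × ℝ := fun q => (q.1, q.2)
  have hr : Measurable r := by
    have : Continuous r := (continuous_projIcc.comp continuous_fst).prodMk
      (continuous_projIcc.comp continuous_snd)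
    exact this.measurable
  have hc : Measurable c := by
    have : Continuous c := by fun_prop
    exact this.measurable
  have hcr : ∀ p : ℝ × ℝ, p.1 ∈ Set.Icc (0 : ℝ) 1 ∧ p.2 ∈ Set.Icc (0 : ℝ) 1 → c (r p) = p := by
    rintro ⟨a, b⟩ ⟨ha, hb⟩
    simp only [c, r, Set.projIcc_of_mem zero_le_one ha, Set.projIcc_of_mem zero_le_one hb]
  have hmap : ∀ ρ : Measure (ℝ × ℝ),
      (∀ᵐ p ∂ρ, p.1 ∈ Set.Icc (0 : ℝ) 1 ∧ p.2 ∈ Set.Icc (0 : ℝ) 1) → (ρ.map r).map c = ρ := by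
    intro ρ hρ
    rw [Measure.map_map hc hr]
    conv_rhs => rw [← Measure.map_id (μ := ρ)]
    exact Measure.map_congr (hρ.mono hcr)
  rw [← hmap μ hμ, ← hmap ν hν]
  congr 1
  let u : BoundedContinuousFunction UnitSquare ℝ :=
    BoundedContinuousFunction.mkOfCompact ⟨fun q => (q.1 : ℝ), by fun_prop⟩
  let w : BoundedContinuousFunction UnitSquare ℝ :=
    BoundedContinuousFunction.mkOfCompact ⟨fun q => (q.2 : ℝ), by fun_prop⟩
  -- The polynomials in the two coordinates separate points, so it suffices to compare integrals on
  -- this subalgebra. It is spanned by the monomials `u ^ j * w ^ k`, whose integrals are the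
  -- moments.
  let A : StarSubalgebra ℝ (BoundedContinuousFunction UnitSquare ℝ) :=
    { Algebra.adjoin ℝ {u, w} with
      star_mem' := fun {a} ha => by
        have : star a = a := by ext q; simp
        rw [this]
        exact ha }
  have hA : ∀ g, g ∈ A ↔ g ∈ Algebra.adjoin ℝ {u, w} := fun g => Iff.rfl
  refine ext_of_forall_mem_subalgebra_integral_eq_of_polish (𝕜 := ℝ) (A := A) ?_ ?_
  · intro q q' hq
    by_cases h1 : q.1 = q'.1
    · have h2 : (q.2 : ℝ) ≠ q'.2 := fun h2 => hq (Prod.ext h1 (Subtype.ext h2))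
      exact ⟨w, ⟨w.toContinuousMap, ⟨w, (hA w).2 (Algebra.subset_adjoin (by simp)), rfl⟩, rfl⟩, h2⟩
    · have h1' : (q.1 : ℝ) ≠ q'.1 := fun h2 => h1 (Subtype.ext h2)
      exact ⟨u, ⟨u.toContinuousMap, ⟨u, (hA u).2 (Algebra.subset_adjoin (by simp)), rfl⟩, rfl⟩, h1'⟩
  · intro g hg
    have hbi : ∀ (ρ : Measure (ℝ × ℝ)) [IsFiniteMeasure ρ] (f : BoundedContinuousFunction UnitSquare ℝ),
        Integrable f (ρ.map r) := fun ρ _ f => f.integrable _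
    rw [hA, ← Subalgebra.mem_toSubmodule, Algebra.adjoin_eq_span] at hg
    induction hg using Submodule.span_induction with
    | mem f hf =>
      obtain ⟨j, k, rfl⟩ := (Submonoid.mem_closure_pair _ _ _).1 hf
      have key : ∀ ρ : Measure (ℝ × ℝ),
          (∀ᵐ p ∂ρ, p.1 ∈ Set.Icc (0 : ℝ) 1 ∧ p.2 ∈ Set.Icc (0 : ℝ) 1) →
          ∫ q, (u ^ j * w ^ k) q ∂(ρ.map r) = ∫ p, p.1 ^ j * p.2 ^ k ∂ρ := by
        intro ρ hρ
        rw [integral_map hr.aemeasurable (u ^ j * w ^ k).continuous.aestronglyMeasurable]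
        refine integral_congr_ae (hρ.mono fun p hp => ?_)
        have := hcr p hp
        simp only [c, Prod.ext_iff] at this
        change ((r p).1 : ℝ) ^ j * ((r p).2 : ℝ) ^ k = _
        rw [this.1, this.2]
      rw [key μ hμ, key ν hν, h j k]
    | zero => simp
    | add f g _ _ hf hg =>
      simp only [BoundedContinuousFunction.coe_add, Pi.add_apply]
      rw [integral_add (hbi μ f) (hbi μ g), integral_add (hbi ν f) (hbi ν g), hf, hg]
    | smul a f _ hf =>
      simp only [BoundedContinuousFunction.coe_smul]
      rw [integral_smul, integral_smul, hf]

/-! ### Bounded coordinates for the statistic `(X, Y)` -/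

/-- The map `(x, y) ↦ (e^{-x}, y (x/n)^n e^{-x})`. If `x` is the sum and `y` the mean ratio of a
sample, the second coordinate is the product of the observations times `e^{-x}`. -/
noncomputable def toUnitSquare (n : ℕ) (p : ℝ × ℝ) : ℝ × ℝ :=
  (Real.exp (-p.1), p.2 * (p.1 / n) ^ n * Real.exp (-p.1))

/-- A left inverse of `toUnitSquare` where the first coordinate is positive. -/
noncomputable def ofUnitSquare (n : ℕ) (q : ℝ × ℝ) : ℝ × ℝ :=
  (-Real.log q.1, q.2 / q.1 / (-Real.log q.1 / n) ^ n)

@[fun_prop]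
theorem measurable_toUnitSquare (n : ℕ) : Measurable (toUnitSquare n) := by
  unfold toUnitSquare; fun_prop

@[fun_prop]
theorem measurable_ofUnitSquare (n : ℕ) : Measurable (ofUnitSquare n) := by
  unfold ofUnitSquare; fun_prop

theorem ofUnitSquare_toUnitSquare {n : ℕ} (hn : n ≠ 0) {p : ℝ × ℝ} (hp : 0 < p.1) :
    ofUnitSquare n (toUnitSquare n p) = p := by
  have h1 : Real.exp (-p.1) ≠ 0 := (Real.exp_pos _).ne'
  have h2 : (p.1 / n) ^ n ≠ 0 := by positivity
  ext
  · simp [ofUnitSquare, toUnitSquare]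
  · simp only [ofUnitSquare, toUnitSquare, Real.log_exp, neg_neg]
    field_simp

/-- The support condition of the laws of the statistic `(X, Y)`. -/
def IsStatisticRange (n : ℕ) (p : ℝ × ℝ) : Prop :=
  0 < p.1 ∧ 0 ≤ p.2 ∧ p.2 * (p.1 / n) ^ n * Real.exp (-p.1) ≤ 1

theorem IsStatisticRange.mem_unitSquare {n : ℕ} {p : ℝ × ℝ} (hp : IsStatisticRange n p) :
    (toUnitSquare n p).1 ∈ Set.Icc (0 : ℝ) 1 ∧ (toUnitSquare n p).2 ∈ Set.Icc (0 : ℝ) 1 := by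
  obtain ⟨h1, h2, h3⟩ := hp
  refine ⟨⟨(Real.exp_pos _).le, Real.exp_le_one_iff.2 (by linarith)⟩, ?_, h3⟩
  simp only [toUnitSquare]
  positivity

/-- A finite law of `(X, Y)` is determined by its mixed moments in the coordinates
`toUnitSquare`. -/
theorem MeasureTheory.Measure.ext_of_moments_toUnitSquare {n : ℕ} (hn : n ≠ 0)
    {μ ν : Measure (ℝ × ℝ)} [IsFiniteMeasure μ] [IsFiniteMeasure ν]
    (hμ : ∀ᵐ p ∂μ, IsStatisticRange n p) (hν : ∀ᵐ p ∂ν, IsStatisticRange n p)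
    (h : ∀ j k : ℕ, ∫ p, (toUnitSquare n p).1 ^ j * (toUnitSquare n p).2 ^ k ∂μ =
      ∫ p, (toUnitSquare n p).1 ^ j * (toUnitSquare n p).2 ^ k ∂ν) : μ = ν := by
  have hsupp : ∀ ρ : Measure (ℝ × ℝ), (∀ᵐ p ∂ρ, IsStatisticRange n p) →
      ∀ᵐ p ∂(ρ.map (toUnitSquare n)), p.1 ∈ Set.Icc (0 : ℝ) 1 ∧ p.2 ∈ Set.Icc (0 : ℝ) 1 := by
    intro ρ hρ
    rw [ae_map_iff (by fun_prop)]
    · exact hρ.mono fun p hp => hp.mem_unitSquare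
    · exact (measurable_fst measurableSet_Icc).inter (measurable_snd measurableSet_Icc)
  have hmap : ∀ ρ : Measure (ℝ × ℝ), (∀ᵐ p ∂ρ, IsStatisticRange n p) →
      (ρ.map (toUnitSquare n)).map (ofUnitSquare n) = ρ := by
    intro ρ hρ
    rw [Measure.map_map (by fun_prop) (by fun_prop)]
    conv_rhs => rw [← Measure.map_id (μ := ρ)]
    exact Measure.map_congr (hρ.mono fun p hp => ofUnitSquare_toUnitSquare hn hp.1)
  rw [← hmap μ hμ, ← hmap ν hν]
  congr 1
  refine ext_of_moments_unitSquare (hsupp μ hμ) (hsupp ν hν) fun j k => ?_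
  have hsm : ∀ ρ : Measure (ℝ × ℝ), AEStronglyMeasurable (fun p : ℝ × ℝ => p.1 ^ j * p.2 ^ k) ρ :=
    fun ρ => (by fun_prop : Continuous fun p : ℝ × ℝ => p.1 ^ j * p.2 ^ k).aestronglyMeasurable
  rw [integral_map (by fun_prop) (hsm _), integral_map (by fun_prop) (hsm _), h]

/-- An integrable function all of whose weighted moments vanish is zero almost everywhere. -/
theorem ae_eq_zero_of_moments_toUnitSquare {n : ℕ} (hn : n ≠ 0) {μ : Measure (ℝ × ℝ)}
    (hμ : ∀ᵐ p ∂μ, IsStatisticRange n p) {g : ℝ × ℝ → ℝ} (hgm : Measurable g)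
    (hg : Integrable g μ)
    (h : ∀ j k : ℕ, ∫ p, g p * ((toUnitSquare n p).1 ^ j * (toUnitSquare n p).2 ^ k) ∂μ = 0) :
    g =ᵐ[μ] 0 := by
  -- The positive and negative parts of `g`, used as densities, define two finite measures with the
  -- same moments. Hence the parts agree almost everywhere, which forces `g = 0`. `ENNReal.ofReal`
  -- does the truncation.
  have hfin : ∀ f : ℝ × ℝ → ℝ, Integrable f μ →
      IsFiniteMeasure (μ.withDensity fun p => ENNReal.ofReal (f p)) := fun f hf =>
    isFiniteMeasure_withDensity_ofReal hf.2
  have := hfin g hg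
  have := hfin (fun p => -g p) hg.neg
  have hae : ∀ f : ℝ × ℝ → ENNReal, ∀ᵐ p ∂(μ.withDensity f), IsStatisticRange n p :=
    fun f => (withDensity_absolutelyContinuous μ f).ae_le hμ
  have hint : ∀ f : ℝ × ℝ → ℝ, Integrable f μ → ∀ j k : ℕ, Integrable
      (fun p => f p * ((toUnitSquare n p).1 ^ j * (toUnitSquare n p).2 ^ k)) μ := by
    intro f hf j k
    refine hf.mul_bdd (c := 1) (by fun_prop) (hμ.mono fun p hp => ?_)
    obtain ⟨⟨h1, h2⟩, h3, h4⟩ := hp.mem_unitSquare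
    rw [Real.norm_of_nonneg (by positivity)]
    exact mul_le_one₀ (pow_le_one₀ h1 h2) (by positivity) (pow_le_one₀ h3 h4)
  have hmom : ∀ f : ℝ × ℝ → ℝ, Measurable f → ∀ j k : ℕ,
      ∫ p, (toUnitSquare n p).1 ^ j * (toUnitSquare n p).2 ^ k
        ∂(μ.withDensity fun p => ENNReal.ofReal (f p)) =
      ∫ p, max (f p) 0 * ((toUnitSquare n p).1 ^ j * (toUnitSquare n p).2 ^ k) ∂μ := by
    intro f hf j k
    have := integral_withDensity_eq_integral_smul (μ := μ) (f := fun p => (f p).toNNReal)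
      hf.real_toNNReal (fun p => (toUnitSquare n p).1 ^ j * (toUnitSquare n p).2 ^ k)
    exact this
  have heq : (μ.withDensity fun p => ENNReal.ofReal (g p)) =
      μ.withDensity fun p => ENNReal.ofReal (-g p) := by
    refine Measure.ext_of_moments_toUnitSquare hn (hae _) (hae _) fun j k => ?_
    rw [hmom g hgm, hmom (fun p => -g p) hgm.neg, ← sub_eq_zero,
      ← integral_sub (hint _ hg.pos_part j k) (hint (fun p => max (-g p) 0) hg.neg.pos_part j k)]
    refine Eq.trans ?_ (h j k)
    refine integral_congr_ae (ae_of_all _ fun p => ?_)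
    simp only [← sub_mul]
    congr 1
    exact max_zero_sub_max_neg_zero_eq_self (g p)
  rw [withDensity_eq_iff (by fun_prop) (by fun_prop)] at heq
  · filter_upwards [heq] with p hp
    by_contra hne
    rcases lt_or_gt_of_ne hne with h0 | h0
    · rw [ENNReal.ofReal_of_nonpos h0.le, eq_comm, ENNReal.ofReal_eq_zero] at hp
      simp only [Pi.zero_apply] at h0
      linarith
    · simp only [Pi.zero_apply] at h0
      rw [ENNReal.ofReal_of_nonpos (by linarith : -g p ≤ 0), ENNReal.ofReal_eq_zero] at hp
      linarith
  · exact (lintegral_ofReal_le_lintegral_enorm g).trans_lt hg.2 |>.ne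

/-! ### The gamma model -/

/-- The product of measures with densities has the product density. -/
theorem MeasureTheory.Measure.pi_withDensity {ι : Type*} [Fintype ι] {X : Type*}
    [MeasurableSpace X] (μ : Measure X) [IsProbabilityMeasure μ] {q : X → ENNReal}
    (hq : Measurable q) [SigmaFinite (μ.withDensity q)] :
    Measure.pi (fun _ : ι => μ.withDensity q) =
      (Measure.pi fun _ : ι => μ).withDensity fun x => ∏ i, q (x i) := by
  refine Measure.pi_eq fun s hs => ?_
  rw [withDensity_apply _ (MeasurableSet.univ_pi hs),
    ← lintegral_indicator (MeasurableSet.univ_pi hs)]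
  have h1 : ∀ x : ι → X, (Set.univ.pi s).indicator (fun x => ∏ i, q (x i)) x =
      ∏ i, (s i).indicator q (x i) := by
    intro x
    by_cases hx : x ∈ Set.univ.pi s
    · rw [Set.indicator_of_mem hx]
      exact Finset.prod_congr rfl fun i _ =>
        (Set.indicator_of_mem (hx i (Set.mem_univ i)) _).symm
    · rw [Set.indicator_of_notMem hx]
      simp only [Set.mem_pi, Set.mem_univ, forall_const, not_forall] at hx
      obtain ⟨i, hi⟩ := hx
      exact (Finset.prod_eq_zero (Finset.mem_univ i) (Set.indicator_of_notMem hi _)).symm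
  simp_rw [h1]
  rw [lintegral_prod_eq_prod_lintegral_of_indepFun Finset.univ
    (fun i (x : ι → X) => (s i).indicator q (x i))
    (iIndepFun_pi (X := fun i => (s i).indicator q) fun i => (hq.indicator (hs i)).aemeasurable)
    (fun i => (hq.indicator (hs i)).comp (measurable_pi_apply i))]
  refine Finset.prod_congr rfl fun i _ => ?_
  rw [withDensity_apply _ (hs i), ← lintegral_indicator (hs i)]
  have := lintegral_map (μ := Measure.pi fun _ : ι => μ) (hq.indicator (hs i))
    (measurable_pi_apply i)
  rw [(measurePreserving_eval (fun _ : ι => μ) i).map_eq] at this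
  exact this.symm

instance (θ : GammaParam) : IsProbabilityMeasure (gammaMeasure θ.shape θ.rate) :=
  isProbabilityMeasure_gammaMeasure θ.shape_pos θ.rate_pos

instance (n : ℕ) (θ : GammaParam) : IsProbabilityMeasure (gammaSample n θ) := by
  unfold gammaSample; infer_instance

theorem ae_pos_gammaMeasure (a r : ℝ) : ∀ᵐ x ∂(gammaMeasure a r), 0 < x := by
  have h0 : ∀ᵐ x ∂(gammaMeasure a r), x ≠ 0 :=
    (withDensity_absolutelyContinuous _ _).ae_le (Measure.ae_ne volume 0)
  have h1 : ∀ᵐ x ∂(gammaMeasure a r), 0 ≤ x := by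
    rw [gammaMeasure, ae_withDensity_iff (by unfold gammaPDF; fun_prop)]
    refine ae_of_all _ fun x hx => ?_
    by_contra hneg
    exact hx (gammaPDF_of_neg (not_le.1 hneg))
  filter_upwards [h0, h1] with x hx0 hx1 using lt_of_le_of_ne hx1 hx0.symm

theorem ae_pos_gammaSample (n : ℕ) (θ : GammaParam) :
    ∀ᵐ x ∂(gammaSample n θ), ∀ i, 0 < x i := by
  rw [ae_all_iff]
  exact fun i => (Measure.quasiMeasurePreserving_eval _ i).ae (ae_pos_gammaMeasure _ _)

/-- Moments of the gamma distribution with an exponential weight. -/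
theorem integral_pow_mul_exp_gammaMeasure {a r : ℝ} (ha : 0 < a) (hr : 0 < r) (k : ℕ) {b : ℝ}
    (hb : 0 ≤ b) :
    ∫ x, x ^ k * Real.exp (-(b * x)) ∂(gammaMeasure a r) =
      r ^ a * Real.Gamma (a + k) / (Real.Gamma a * (r + b) ^ (a + k)) := by
  have h1 := integral_withDensity_eq_integral_smul (μ := volume)
    (f := fun x => (gammaPDFReal a r x).toNNReal) (by fun_prop)
    (fun x => x ^ k * Real.exp (-(b * x)))
  rw [gammaMeasure]
  refine h1.trans ?_
  have h2 : ∀ x, (gammaPDFReal a r x).toNNReal • (x ^ k * Real.exp (-(b * x))) =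
      gammaPDFReal a r x * (x ^ k * Real.exp (-(b * x))) := fun x => by
    rw [NNReal.smul_def, Real.coe_toNNReal _ (gammaPDFReal_nonneg ha hr x), smul_eq_mul]
  simp_rw [h2]
  rw [← setIntegral_eq_integral_of_ae_compl_eq_zero (s := Set.Ioi 0)]
  · have h3 : ∀ x ∈ Set.Ioi (0 : ℝ), gammaPDFReal a r x * (x ^ k * Real.exp (-(b * x))) =
        r ^ a / Real.Gamma a * (x ^ (a + k - 1) * Real.exp (-((r + b) * x))) := by
      intro x hx
      have hx : 0 < x := hx
      rw [gammaPDFReal, if_pos hx.le, show a + k - 1 = (a - 1) + k by ring,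
        Real.rpow_add hx, Real.rpow_natCast, show -((r + b) * x) = -(r * x) + -(b * x) by ring,
        Real.exp_add]
      ring
    rw [setIntegral_congr_fun measurableSet_Ioi h3, integral_const_mul,
      Real.integral_rpow_mul_exp_neg_mul_Ioi (by positivity) (by positivity),
      Real.div_rpow zero_le_one (by positivity), Real.one_rpow]
    ring
  · filter_upwards [Measure.ae_ne volume (0 : ℝ)] with x hx0 hx
    have : x < 0 := lt_of_le_of_ne (not_lt.1 hx) hx0
    rw [gammaPDFReal, if_neg (not_le.2 this), zero_mul]

theorem measurable_sampleSum (n : ℕ) : Measurable (sampleSum (n := n)) := by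
  unfold sampleSum; fun_prop

theorem measurable_meanRatio (n : ℕ) : Measurable (meanRatio (n := n)) := by
  unfold meanRatio sampleMean sampleSum; fun_prop

theorem measurable_gammaStatistic (n : ℕ) : Measurable (gammaStatistic (n := n)) :=
  (measurable_sampleSum n).prodMk (measurable_meanRatio n)

theorem sampleSum_pos {n : ℕ} (hn : n ≠ 0) {x : Fin n → ℝ} (hx : ∀ i, 0 < x i) :
    0 < sampleSum x :=
  Finset.sum_pos (fun i _ => hx i) ⟨⟨0, Nat.pos_of_ne_zero hn⟩, Finset.mem_univ _⟩

theorem sampleMean_pos {n : ℕ} (hn : n ≠ 0) {x : Fin n → ℝ} (hx : ∀ i, 0 < x i) :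
    0 < sampleMean x := by
  have := sampleSum_pos hn hx
  unfold sampleMean; positivity

theorem meanRatio_mul_pow {n : ℕ} (hn : n ≠ 0) {x : Fin n → ℝ} (hx : ∀ i, 0 < x i) :
    meanRatio x * (sampleSum x / n) ^ n = ∏ i, x i := by
  have h := (pow_pos (sampleMean_pos hn hx) n).ne'
  exact div_mul_cancel₀ _ h

/-- In the coordinates `toUnitSquare`, monomials in the statistic are products of functions of
the single observations. -/
theorem toUnitSquare_gammaStatistic {n : ℕ} (hn : n ≠ 0) {x : Fin n → ℝ} (hx : ∀ i, 0 < x i)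
    (j k : ℕ) :
    (toUnitSquare n (gammaStatistic x)).1 ^ j * (toUnitSquare n (gammaStatistic x)).2 ^ k =
      ∏ i, (x i ^ k * Real.exp (-(((j : ℝ) + k) * x i))) := by
  simp only [toUnitSquare, gammaStatistic, meanRatio_mul_pow hn hx]
  rw [Finset.prod_mul_distrib, Finset.prod_pow, ← Real.exp_sum, mul_pow, ← Real.exp_nat_mul,
    ← Real.exp_nat_mul, mul_left_comm, ← Real.exp_add]
  congr 2
  rw [Finset.sum_neg_distrib, ← Finset.mul_sum, sampleSum]
  ring

/-- The upper bound is the product over the observations of `t e^{-t} ≤ 1`. -/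
theorem isStatisticRange_gammaStatistic {n : ℕ} (hn : n ≠ 0) {x : Fin n → ℝ}
    (hx : ∀ i, 0 < x i) : IsStatisticRange n (gammaStatistic x) := by
  refine ⟨sampleSum_pos hn hx, ?_, ?_⟩
  · exact div_nonneg (Finset.prod_nonneg fun i _ => (hx i).le)
      (pow_nonneg (sampleMean_pos hn hx).le n)
  · have := toUnitSquare_gammaStatistic hn hx 0 1
    simp only [pow_zero, one_mul, pow_one, toUnitSquare] at this
    rw [this]
    refine Finset.prod_le_one (fun i _ => mul_nonneg (hx i).le (Real.exp_pos _).le) fun i _ => ?_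
    have h1 := Real.add_one_le_exp (x i)
    have h2 : x i * Real.exp (-x i) ≤ Real.exp (x i) * Real.exp (-x i) := by
      gcongr; linarith
    rw [← Real.exp_add, add_neg_cancel, Real.exp_zero] at h2
    simpa using h2

theorem ae_isStatisticRange_map_gammaStatistic {n : ℕ} (hn : n ≠ 0) (θ : GammaParam) :
    ∀ᵐ p ∂((gammaSample n θ).map gammaStatistic), IsStatisticRange n p := by
  rw [ae_map_iff (measurable_gammaStatistic n).aemeasurable]
  · exact (ae_pos_gammaSample n θ).mono fun x hx => isStatisticRange_gammaStatistic hn hx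
  · have h : Measurable fun p : ℝ × ℝ => p.2 * (p.1 / n) ^ n * Real.exp (-p.1) := by fun_prop
    exact (measurableSet_lt measurable_const measurable_fst).inter
      ((measurableSet_le measurable_const measurable_snd).inter
        (measurableSet_le h measurable_const))

/-- The mixed moments of the law of `(X, Y)` in the coordinates `toUnitSquare`. -/
theorem moments_gammaStatistic {n : ℕ} (hn : n ≠ 0) (θ : GammaParam) (j k : ℕ) :
    ∫ p, (toUnitSquare n p).1 ^ j * (toUnitSquare n p).2 ^ k
        ∂((gammaSample n θ).map gammaStatistic) =
      (θ.rate ^ θ.shape * Real.Gamma (θ.shape + k) /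
        (Real.Gamma θ.shape * (θ.rate + (j + k)) ^ (θ.shape + k))) ^ n := by
  rw [integral_map (measurable_gammaStatistic n).aemeasurable (by fun_prop),
    integral_congr_ae ((ae_pos_gammaSample n θ).mono fun x hx =>
      toUnitSquare_gammaStatistic hn hx j k), gammaSample,
    integral_fintype_prod_eq_pow (fun t : ℝ => t ^ k * Real.exp (-(((j : ℝ) + k) * t))),
    integral_pow_mul_exp_gammaMeasure θ.shape_pos θ.rate_pos k (by positivity), Fintype.card_fin]

/-! ### Sufficiency and completeness of `(X, Y)` -/

/-- The parameter `α = λ = 1`. -/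
def GammaParam.unit : GammaParam := ⟨1, 1, one_pos, one_pos⟩

/-- The density of the law of `(X, Y)` with respect to its law under `α = λ = 1`. -/
noncomputable def statisticDensity (n : ℕ) (θ : GammaParam) (p : ℝ × ℝ) : ℝ :=
  (θ.rate ^ θ.shape / Real.Gamma θ.shape) ^ n *
    ((p.2 * (p.1 / n) ^ n) ^ (θ.shape - 1) * Real.exp (-((θ.rate - 1) * p.1)))

theorem measurable_statisticDensity (n : ℕ) (θ : GammaParam) :
    Measurable (statisticDensity n θ) := by
  unfold statisticDensity; fun_prop

/-- The likelihood ratio of one observation is `c x^(α-1) e^{-(λ-1)x}`. In the product over the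
sample the powers combine to a power of `∏ xᵢ = Y (X/n)^n` and the exponents add up to a multiple of
`X`. -/
theorem gammaSample_eq_withDensity {n : ℕ} (hn : n ≠ 0) (θ : GammaParam) :
    gammaSample n θ = (gammaSample n .unit).withDensity
      fun x => ((statisticDensity n θ (gammaStatistic x)).toNNReal : ENNReal) := by
  set c := θ.rate ^ θ.shape / Real.Gamma θ.shape with hc
  have hc0 : 0 < c := div_pos (Real.rpow_pos_of_pos θ.rate_pos _)
    (Real.Gamma_pos_of_pos θ.shape_pos)
  let q : ℝ → ℝ := fun x => c * (x ^ (θ.shape - 1) * Real.exp (-((θ.rate - 1) * x)))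
  have hq : Measurable fun x => ENNReal.ofReal (q x) := by fun_prop
  have h1 : gammaMeasure θ.shape θ.rate =
      (gammaMeasure GammaParam.unit.shape GammaParam.unit.rate).withDensity
        fun x => ENNReal.ofReal (q x) := by
    rw [gammaMeasure, gammaMeasure, ← withDensity_mul _ (by unfold gammaPDF; fun_prop) hq]
    refine withDensity_congr_ae ?_
    filter_upwards [Measure.ae_ne volume (0 : ℝ)] with x hx0
    rw [Pi.mul_apply]
    rcases lt_or_gt_of_ne hx0 with hx | hx
    · rw [gammaPDF_of_neg hx, gammaPDF_of_neg hx, zero_mul]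
    · rw [gammaPDF_of_nonneg hx.le, gammaPDF_of_nonneg hx.le, ← ENNReal.ofReal_mul]
      · congr 1
        simp only [GammaParam.unit, q, hc, Real.one_rpow, Real.Gamma_one, sub_self,
          Real.rpow_zero, one_mul, div_one]
        rw [show -(θ.rate * x) = -x + -((θ.rate - 1) * x) by ring, Real.exp_add]
        ring
      · simp only [GammaParam.unit, Real.one_rpow, Real.Gamma_one]
        positivity
  have hpi : gammaSample n θ = (gammaSample n .unit).withDensity
      fun x => ∏ i, ENNReal.ofReal (q (x i)) := by
    have : SigmaFinite ((gammaMeasure GammaParam.unit.shape GammaParam.unit.rate).withDensity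
        fun x => ENNReal.ofReal (q x)) := by rw [← h1]; infer_instance
    unfold gammaSample
    rw [h1]
    exact Measure.pi_withDensity _ hq
  rw [hpi]
  refine withDensity_congr_ae ((ae_pos_gammaSample n _).mono fun x hx => ?_)
  have hq0 : ∀ i ∈ Finset.univ, 0 ≤ q (x i) := fun i _ => by
    have := hx i
    positivity
  simp only
  rw [← ENNReal.ofReal_prod_of_nonneg hq0]
  change _ = ENNReal.ofReal _
  congr 1
  simp only [statisticDensity, gammaStatistic, meanRatio_mul_pow hn hx, q]
  rw [Finset.prod_mul_distrib, Finset.prod_mul_distrib, ← Real.exp_sum, Finset.prod_const,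
    Finset.card_univ, Fintype.card_fin, Real.finsetProd_rpow _ _ fun i _ => (hx i).le,
    Finset.sum_neg_distrib, ← Finset.mul_sum, sampleSum]

theorem hasFactoredDensity_gammaSample {n : ℕ} (hn : n ≠ 0) :
    HasFactoredDensity (gammaSample n) gammaStatistic .unit := fun θ =>
  ⟨fun p => (statisticDensity n θ p).toNNReal, (measurable_statisticDensity n θ).real_toNNReal,
    gammaSample_eq_withDensity hn θ⟩

/-- At `α = 1 + k`, `λ = 1 + j + k` the likelihood ratio is a constant times the monomial with
exponents `j, k` in the coordinates `toUnitSquare`. These parameters alone make every weighted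
moment of `g` vanish under `α = λ = 1`, and all other laws are absolutely continuous with respect to
that one. -/
theorem isCompleteStatistic_gammaStatistic {n : ℕ} (hn : n ≠ 0) :
    IsCompleteStatistic (gammaSample n) (gammaStatistic (n := n)) := by
  intro g hg hub
  have hS := measurable_gammaStatistic n
  suffices h : (fun x => g (gammaStatistic x)) =ᵐ[gammaSample n .unit] fun _ => 0 by
    intro θ
    rw [gammaSample_eq_withDensity hn θ]
    exact (withDensity_absolutelyContinuous _ _).ae_le h
  refine ae_of_ae_map hS.aemeasurable
    (ae_eq_zero_of_moments_toUnitSquare hn (ae_isStatisticRange_map_gammaStatistic hn _) hg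
      ((integrable_map_measure hg.aestronglyMeasurable hS.aemeasurable).2 (hub .unit).1) ?_)
  intro j k
  rw [integral_map hS.aemeasurable (by fun_prop)]
  let θ : GammaParam := ⟨1 + k, 1 + (j + k), by positivity, by positivity⟩
  set c := (θ.rate ^ θ.shape / Real.Gamma θ.shape) ^ n with hc
  have hc0 : 0 < c := pow_pos (div_pos (Real.rpow_pos_of_pos θ.rate_pos _)
    (Real.Gamma_pos_of_pos θ.shape_pos)) n
  have h0 := (hub θ).2
  rw [gammaSample_eq_withDensity hn θ, integral_withDensity_eq_integral_smul
    (f := fun x => (statisticDensity n θ (gammaStatistic x)).toNNReal)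
    ((measurable_statisticDensity n θ).comp hS).real_toNNReal] at h0
  have h1 : ∀ᵐ x ∂(gammaSample n .unit),
      (statisticDensity n θ (gammaStatistic x)).toNNReal • g (gammaStatistic x) =
        c * (g (gammaStatistic x) * ((toUnitSquare n (gammaStatistic x)).1 ^ j *
          (toUnitSquare n (gammaStatistic x)).2 ^ k)) := by
    filter_upwards [ae_pos_gammaSample n .unit] with x hx
    have h2 : statisticDensity n θ (gammaStatistic x) =
        c * ((toUnitSquare n (gammaStatistic x)).1 ^ j *
          (toUnitSquare n (gammaStatistic x)).2 ^ k) := by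
      rw [toUnitSquare_gammaStatistic hn hx]
      simp only [statisticDensity, gammaStatistic, meanRatio_mul_pow hn hx, ← hc]
      simp only [θ, add_sub_cancel_left, Real.rpow_natCast]
      rw [Finset.prod_mul_distrib, Finset.prod_pow, ← Real.exp_sum, Finset.sum_neg_distrib,
        ← Finset.mul_sum, sampleSum]
    have h3 : 0 ≤ statisticDensity n θ (gammaStatistic x) := by
      rw [h2, toUnitSquare_gammaStatistic hn hx]
      exact mul_nonneg hc0.le (Finset.prod_nonneg fun i _ =>
        mul_nonneg (pow_nonneg (hx i).le _) (Real.exp_pos _).le)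
    rw [NNReal.smul_def, Real.coe_toNNReal _ h3, smul_eq_mul, h2]
    ring
  rw [integral_congr_ae h1, integral_const_mul] at h0
  exact (mul_eq_zero.1 h0).resolve_left hc0.ne'

/-! ### Gauss's summation formula -/

theorem lintegral_beta {a b : ℝ} (ha : 0 < a) (hb : 0 < b) :
    ∫⁻ x in Set.Ioo (0 : ℝ) 1, ENNReal.ofReal (x ^ (a - 1) * (1 - x) ^ (b - 1)) =
      ENNReal.ofReal (Real.Gamma a * Real.Gamma b / Real.Gamma (a + b)) := by
  have h := lintegral_betaPDF_eq_one ha hb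
  have h0 := beta_pos ha hb
  rw [lintegral_betaPDF] at h
  have h1 : ∀ x, ENNReal.ofReal (1 / beta a b * x ^ (a - 1) * (1 - x) ^ (b - 1)) =
      ENNReal.ofReal (1 / beta a b) * ENNReal.ofReal (x ^ (a - 1) * (1 - x) ^ (b - 1)) := fun x => by
    rw [← ENNReal.ofReal_mul (by positivity), mul_assoc]
  simp_rw [h1] at h
  rw [lintegral_const_mul _ (by fun_prop)] at h
  calc ∫⁻ x in Set.Ioo (0 : ℝ) 1, ENNReal.ofReal (x ^ (a - 1) * (1 - x) ^ (b - 1))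
      = ENNReal.ofReal (beta a b) * (ENNReal.ofReal (1 / beta a b) *
        ∫⁻ x in Set.Ioo (0 : ℝ) 1, ENNReal.ofReal (x ^ (a - 1) * (1 - x) ^ (b - 1))) := by
        rw [← mul_assoc, ← ENNReal.ofReal_mul h0.le, mul_one_div_cancel h0.ne', ENNReal.ofReal_one,
          one_mul]
    _ = _ := by rw [h, mul_one, beta]

theorem lintegral_gamma {a r : ℝ} (ha : 0 < a) (hr : 0 < r) :
    ∫⁻ x in Set.Ioi (0 : ℝ), ENNReal.ofReal (x ^ (a - 1) * Real.exp (-(r * x))) =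
      ENNReal.ofReal (Real.Gamma a * r ^ (-a)) := by
  have h := Real.integral_rpow_mul_exp_neg_mul_Ioi ha hr
  have h0 : (1 / r) ^ a * Real.Gamma a = Real.Gamma a * r ^ (-a) := by
    rw [one_div, Real.inv_rpow hr.le, Real.rpow_neg hr.le, mul_comm]
  rw [h0] at h
  rw [← h, ofReal_integral_eq_lintegral_ofReal]
  -- The integral of a non-integrable function is `0` by convention, so the nonzero value already
  -- proves integrability.
  · refine not_imp_comm.1 integral_undef ?_
    rw [h]
    have := Real.Gamma_pos_of_pos ha
    positivity
  · exact ae_restrict_of_forall_mem measurableSet_Ioi fun x hx => by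
      have hx : 0 < x := hx
      positivity

/-- The binomial series with a negative exponent, in terms of the Gamma function. -/
theorem tsum_Gamma_mul_pow {b t : ℝ} (hb : 0 < b) (ht0 : 0 ≤ t) (ht1 : t < 1) :
    ∑' l : ℕ, ENNReal.ofReal (Real.Gamma (b + l) / l.factorial * t ^ l) =
      ENNReal.ofReal (Real.Gamma b * (1 - t) ^ (-b)) := by
  -- Write `Γ(b + l)` as Euler's integral; the sum under the integral sign is then the series of
  -- `e^{xt}`, leaving a Gamma integral with rate `1 - t`.
  have h1 : ∀ l : ℕ, ENNReal.ofReal (Real.Gamma (b + l) / l.factorial * t ^ l) =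
      ∫⁻ x in Set.Ioi (0 : ℝ), ENNReal.ofReal (x ^ (b - 1) * Real.exp (-(1 * x)) *
        ((x * t) ^ l / l.factorial)) := by
    intro l
    have hbl : 0 < b + l := by positivity
    have h2 : ∀ x ∈ Set.Ioi (0 : ℝ), ENNReal.ofReal (x ^ (b - 1) * Real.exp (-(1 * x)) *
        ((x * t) ^ l / l.factorial)) = ENNReal.ofReal (t ^ l / l.factorial) *
          ENNReal.ofReal (x ^ (b + l - 1) * Real.exp (-(1 * x))) := by
      intro x hx
      have hx : 0 < x := hx
      rw [← ENNReal.ofReal_mul (by positivity), show b + l - 1 = b - 1 + l by ring,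
        Real.rpow_add hx, Real.rpow_natCast]
      congr 1
      ring
    rw [setLIntegral_congr_fun measurableSet_Ioi h2, lintegral_const_mul _ (by fun_prop),
      lintegral_gamma hbl one_pos, ← ENNReal.ofReal_mul (by positivity), Real.one_rpow]
    congr 1
    ring
  simp_rw [h1]
  rw [← lintegral_tsum fun l => by fun_prop, ← lintegral_gamma hb (sub_pos.2 ht1)]
  refine setLIntegral_congr_fun measurableSet_Ioi fun x hx => ?_
  have hx : 0 < x := hx
  rw [← ENNReal.ofReal_tsum_of_nonneg (fun l => by positivity)
    ((Real.summable_pow_div_factorial _).mul_left _), tsum_mul_left]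
  congr 1
  have hexp : ∑' l : ℕ, (x * t) ^ l / (l.factorial : ℝ) = Real.exp (x * t) := by
    rw [Real.exp_eq_exp_ℝ, NormedSpace.exp_eq_tsum_div]
  rw [hexp, mul_assoc, ← Real.exp_add]
  congr 2
  ring

/-- **Gauss's summation formula** for the hypergeometric series at `1`. -/
theorem tsum_Gamma_gauss {a b s : ℝ} (ha : 0 < a) (hb : 0 < b) (hs : 0 < s) :
    ∑' l : ℕ, ENNReal.ofReal (Real.Gamma (a + l) * Real.Gamma (b + l) /
        (l.factorial * Real.Gamma (a + b + s + l))) =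
      ENNReal.ofReal (Real.Gamma a * Real.Gamma b * Real.Gamma s /
        (Real.Gamma (b + s) * Real.Gamma (a + s))) := by
  have hbs := Real.Gamma_pos_of_pos (add_pos hb hs)
  have hΓb := Real.Gamma_pos_of_pos hb
  -- `Γ(a+l) Γ(b+s) / Γ(a+b+s+l)` is a beta integral. Summing inside it by the binomial series gives
  -- a factor `(1-t)^(-b)`, and a beta integral with parameters `a, s` remains. Sum and integral
  -- commute because all terms are nonnegative.
  have h1 : ∀ l : ℕ, ENNReal.ofReal (Real.Gamma (a + l) * Real.Gamma (b + l) /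
        (l.factorial * Real.Gamma (a + b + s + l))) =
      ENNReal.ofReal (1 / Real.Gamma (b + s)) * ∫⁻ t in Set.Ioo (0 : ℝ) 1,
        ENNReal.ofReal (t ^ (a - 1) * (1 - t) ^ (b + s - 1)) *
          ENNReal.ofReal (Real.Gamma (b + l) / l.factorial * t ^ l) := by
    intro l
    have hal : 0 < a + l := by positivity
    have hbl := Real.Gamma_pos_of_pos (by positivity : 0 < b + l)
    have h2 : ∀ t ∈ Set.Ioo (0 : ℝ) 1,
        ENNReal.ofReal (t ^ (a - 1) * (1 - t) ^ (b + s - 1)) *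
          ENNReal.ofReal (Real.Gamma (b + l) / l.factorial * t ^ l) =
        ENNReal.ofReal (Real.Gamma (b + l) / l.factorial) *
          ENNReal.ofReal (t ^ (a + l - 1) * (1 - t) ^ (b + s - 1)) := by
      intro t ht
      have ht0 : 0 < t := ht.1
      have ht1 : 0 < 1 - t := sub_pos.2 ht.2
      rw [← ENNReal.ofReal_mul (by positivity), ← ENNReal.ofReal_mul (by positivity),
        show a + l - 1 = a - 1 + l by ring, Real.rpow_add ht0, Real.rpow_natCast]
      congr 1
      ring
    rw [setLIntegral_congr_fun measurableSet_Ioo h2, lintegral_const_mul _ (by fun_prop),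
      lintegral_beta hal (add_pos hb hs), ← ENNReal.ofReal_mul (by positivity),
      ← ENNReal.ofReal_mul (by positivity), show a + l + (b + s) = a + b + s + l by ring]
    congr 1
    field_simp
  simp_rw [h1]
  rw [ENNReal.tsum_mul_left, ← lintegral_tsum fun l => by fun_prop]
  have h3 : ∀ t ∈ Set.Ioo (0 : ℝ) 1,
      ∑' l : ℕ, ENNReal.ofReal (t ^ (a - 1) * (1 - t) ^ (b + s - 1)) *
          ENNReal.ofReal (Real.Gamma (b + l) / l.factorial * t ^ l) =
        ENNReal.ofReal (Real.Gamma b) * ENNReal.ofReal (t ^ (a - 1) * (1 - t) ^ (s - 1)) := by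
    intro t ht
    have ht0 : 0 < t := ht.1
    have ht1 : 0 < 1 - t := sub_pos.2 ht.2
    rw [ENNReal.tsum_mul_left, tsum_Gamma_mul_pow hb ht0.le ht.2,
      ← ENNReal.ofReal_mul (by positivity), ← ENNReal.ofReal_mul (by positivity),
      show s - 1 = b + s - 1 + -b by ring, Real.rpow_add ht1]
    congr 1
    ring
  rw [setLIntegral_congr_fun measurableSet_Ioo h3, lintegral_const_mul _ (by fun_prop),
    lintegral_beta ha hs, ← ENNReal.ofReal_mul hΓb.le, ← ENNReal.ofReal_mul (by positivity)]
  congr 1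
  field_simp

/-! ### The coefficients and the density of `Y` -/

/-- The Cauchy product of a double series of extended nonnegative reals. -/
theorem ENNReal.tsum_sum_range_eq_tsum_tsum (f : ℕ → ℕ → ENNReal) :
    ∑' m, ∑ k ∈ Finset.range (m + 1), f k (m - k) = ∑' k, ∑' l, f k l := by
  rw [← ENNReal.tsum_prod, ← Finset.HasAntidiagonal.sigmaAntidiagonalEquivProd.tsum_eq, ENNReal.tsum_sigma']
  refine tsum_congr fun m => ?_
  rw [← Finset.Nat.sum_antidiagonal_eq_sum_range_succ, tsum_fintype,
    ← Finset.sum_coe_sort (Finset.HasAntidiagonal.antidiagonal m)]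
  rfl

theorem glaserCoeff_nonneg (n j m : ℕ) : 0 ≤ glaserCoeff n j m := by
  induction j generalizing m with
  | zero => simp only [glaserCoeff]; split_ifs <;> norm_num
  | succ j ih =>
    simp only [glaserCoeff]
    refine mul_nonneg (div_nonneg (Real.Gamma_nonneg_of_nonneg (by positivity))
      (Real.Gamma_nonneg_of_nonneg (by positivity))) (Finset.sum_nonneg fun k _ =>
        mul_nonneg (div_nonneg (Real.Gamma_nonneg_of_nonneg (by positivity)) (by positivity))
          (ih k))

theorem glaserCoeff_zero_pos {n : ℕ} (hn : n ≠ 0) (j : ℕ) : 0 < glaserCoeff n j 0 := by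
  induction j with
  | zero => simp [glaserCoeff]
  | succ j ih =>
    have hn' : (0 : ℝ) < n := by positivity
    simp only [glaserCoeff, zero_add, Finset.sum_range_one, Nat.sub_self, Nat.factorial_zero,
      Nat.cast_zero, Nat.cast_one, div_one]
    refine mul_pos (div_pos (Real.Gamma_pos_of_pos (by positivity))
      (Real.Gamma_pos_of_pos (by positivity))) (mul_pos (Real.Gamma_pos_of_pos (by positivity)) ih)

/-- The exponent parameter `(j+1)(j+2)/(2n)` of the partial products of beta variables. -/
noncomputable def glaserExponent (n j : ℕ) : ℝ := ((j : ℝ) + 1) * (j + 2) / (2 * n)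

/-- Up to a constant, the Mellin transform of the density of the product of independent beta
variables with parameters `(α, k/n)`, `1 ≤ k ≤ j`. -/
noncomputable def glaserMellin (n j : ℕ) (s : ℝ) : ℝ :=
  ∏ k ∈ Finset.range j, Real.Gamma (((k : ℝ) + 1) / n) * Real.Gamma s /
    Real.Gamma (s + ((k : ℝ) + 1) / n)

theorem glaserMellin_pos {n : ℕ} (hn : n ≠ 0) (j : ℕ) {s : ℝ} (hs : 0 < s) :
    0 < glaserMellin n j s := by
  have hn' : (0 : ℝ) < n := by positivity
  exact Finset.prod_pos fun k _ => div_pos (mul_pos (Real.Gamma_pos_of_pos (by positivity))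
    (Real.Gamma_pos_of_pos hs)) (Real.Gamma_pos_of_pos (by positivity))

/-- Induction on `j`. The Gamma quotient in the recursion replaces `Γ(B+b+m)` by `Γ(B+m)`, where `B`
is the old exponent and `b = (j+2)/n`. With `m = k + l`, the sum over `l` is then a Gauss series
with parameters `B+k, b, s`, and its value is the term `k` of the previous stage times the new
factor `Γ(b)Γ(s)/Γ(b+s)`. -/
theorem tsum_glaserCoeff {n : ℕ} (hn : n ≠ 0) (j : ℕ) {s : ℝ} (hs : 0 < s) :
    ∑' m : ℕ, ENNReal.ofReal (glaserCoeff n j m * (Real.Gamma s *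
        Real.Gamma (glaserExponent n j + m) / Real.Gamma (s + (glaserExponent n j + m)))) =
      ENNReal.ofReal (glaserMellin n (j + 1) s) := by
  have hn' : (0 : ℝ) < n := by positivity
  induction j with
  | zero =>
    rw [tsum_eq_single 0 fun m hm => by simp [glaserCoeff, hm]]
    have : glaserExponent n 0 = 1 / n := by
      simp only [glaserExponent, Nat.cast_zero]
      field_simp
      norm_num
    rw [this]
    simp only [glaserCoeff, glaserMellin, Finset.prod_range_one, if_true, one_mul, Nat.cast_zero,
      add_zero, zero_add]
    congr 1
    ring
  | succ j ih =>
    set B := glaserExponent n j with hB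
    set b : ℝ := ((j : ℝ) + 2) / n with hb
    have hB0 : 0 < B := by simp only [hB, glaserExponent]; positivity
    have hb0 : 0 < b := by positivity
    have hB' : glaserExponent n (j + 1) = B + b := by
      simp only [hB, hb, glaserExponent, Nat.cast_add, Nat.cast_one]
      field_simp
      ring
    have hΓs := Real.Gamma_pos_of_pos hs
    have hΓb := Real.Gamma_pos_of_pos hb0
    have hΓbs := Real.Gamma_pos_of_pos (add_pos hb0 hs)
    have hterm : ∀ m : ℕ, ENNReal.ofReal (glaserCoeff n (j + 1) m * (Real.Gamma s *
        Real.Gamma (glaserExponent n (j + 1) + m) /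
          Real.Gamma (s + (glaserExponent n (j + 1) + m)))) =
        ∑ k ∈ Finset.range (m + 1), ENNReal.ofReal (glaserCoeff n j k * Real.Gamma s) *
          ENNReal.ofReal (Real.Gamma (B + k + (m - k : ℕ)) * Real.Gamma (b + (m - k : ℕ)) /
            ((m - k).factorial * Real.Gamma (B + k + b + s + (m - k : ℕ)))) := by
      intro m
      have h1 : ∀ k ∈ Finset.range (m + 1), ENNReal.ofReal (glaserCoeff n j k * Real.Gamma s) *
          ENNReal.ofReal (Real.Gamma (B + k + (m - k : ℕ)) * Real.Gamma (b + (m - k : ℕ)) /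
            ((m - k).factorial * Real.Gamma (B + k + b + s + (m - k : ℕ)))) =
          ENNReal.ofReal (Real.Gamma s * Real.Gamma (B + m) / Real.Gamma (s + (B + b + m)) *
            (Real.Gamma (((m - k : ℕ) : ℝ) + b) / (m - k).factorial * glaserCoeff n j k)) := by
        intro k hk
        have hkm : k ≤ m := Nat.lt_succ_iff.1 (Finset.mem_range.1 hk)
        rw [← ENNReal.ofReal_mul (mul_nonneg (glaserCoeff_nonneg n j k) hΓs.le)]
        have e1 : B + k + ((m - k : ℕ) : ℝ) = B + m := by rw [Nat.cast_sub hkm]; ring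
        have e2 : B + k + b + s + ((m - k : ℕ) : ℝ) = s + (B + b + m) := by
          rw [Nat.cast_sub hkm]; ring
        rw [e1, e2, add_comm b]
        congr 1
        ring
      rw [Finset.sum_congr rfl h1, ← ENNReal.ofReal_sum_of_nonneg, ← Finset.mul_sum, hB']
      · congr 1
        have hΓ : Real.Gamma (B + b + m) ≠ 0 := (Real.Gamma_pos_of_pos (by positivity)).ne'
        simp only [glaserCoeff]
        have e3 : (m : ℝ) + ((j : ℝ) + 1) * (j + 2) / (2 * n) = B + m := by
          rw [hB, glaserExponent, add_comm]
        have e4 : (m : ℝ) + ((j : ℝ) + 2) * (j + 3) / (2 * n) = B + b + m := by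
          rw [← hB', glaserExponent, Nat.cast_add, Nat.cast_one]
          ring
        rw [e3, e4, ← hb]
        field_simp
      · intro k _
        exact mul_nonneg (div_nonneg (mul_nonneg hΓs.le
          (Real.Gamma_nonneg_of_nonneg (by positivity)))
          (Real.Gamma_nonneg_of_nonneg (by positivity))) (mul_nonneg (div_nonneg
          (Real.Gamma_nonneg_of_nonneg (by positivity)) (by positivity))
          (glaserCoeff_nonneg n j k))
    simp_rw [hterm]
    rw [ENNReal.tsum_sum_range_eq_tsum_tsum fun k l =>
      ENNReal.ofReal (glaserCoeff n j k * Real.Gamma s) *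
        ENNReal.ofReal (Real.Gamma (B + k + l) * Real.Gamma (b + l) /
            (l.factorial * Real.Gamma (B + k + b + s + l)))]
    have hinner : ∀ k : ℕ, ∑' l : ℕ, ENNReal.ofReal (glaserCoeff n j k * Real.Gamma s) *
        ENNReal.ofReal (Real.Gamma (B + k + l) * Real.Gamma (b + l) /
            (l.factorial * Real.Gamma (B + k + b + s + l))) =
        ENNReal.ofReal (Real.Gamma b * Real.Gamma s / Real.Gamma (b + s)) *
          ENNReal.ofReal (glaserCoeff n j k * (Real.Gamma s *
            Real.Gamma (B + k) / Real.Gamma (s + (B + k)))) := by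
      intro k
      rw [ENNReal.tsum_mul_left, tsum_Gamma_gauss (by positivity) hb0 hs,
        ← ENNReal.ofReal_mul (mul_nonneg (glaserCoeff_nonneg n j k) hΓs.le),
        ← ENNReal.ofReal_mul (by positivity), add_comm s (B + k)]
      congr 1
      field_simp
    simp_rw [hinner]
    rw [ENNReal.tsum_mul_left, ih, ← ENNReal.ofReal_mul (by positivity), glaserMellin,
      glaserMellin, Finset.prod_range_succ _ (j + 1)]
    congr 1
    have e5 : (((j + 1 : ℕ) : ℝ) + 1) / n = b := by
      rw [hb]; push_cast; ring
    rw [e5, add_comm s b]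
    ring

/-! ### The law of `(X, Y)` -/

theorem glaserExponent_sub_two {n : ℕ} (hn : 2 ≤ n) :
    glaserExponent n (n - 2) = ((n : ℝ) - 3) / 2 + 1 := by
  have hn' : (0 : ℝ) < n := by positivity
  rw [glaserExponent, Nat.cast_sub hn]
  push_cast
  field_simp
  ring

theorem glaserD_nonneg (n m : ℕ) : 0 ≤ glaserD n m := glaserCoeff_nonneg _ _ _

/-- The Mellin transform of `(1-y)^((n-3)/2) G(y)`, with `G` in extended nonnegative reals. -/
theorem lintegral_glaser_tsum {n : ℕ} (hn : 2 ≤ n) {s : ℝ} (hs : 0 < s) :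
    ∫⁻ y in Set.Ioo (0 : ℝ) 1, ENNReal.ofReal (y ^ (s - 1) * (1 - y) ^ (((n : ℝ) - 3) / 2)) *
        ∑' m, ENNReal.ofReal (glaserD n m * (1 - y) ^ m) =
      ENNReal.ofReal (glaserMellin n (n - 1) s) := by
  have hn0 : n ≠ 0 := by omega
  have hB0 : 0 < glaserExponent n (n - 2) := by
    have : (0 : ℝ) < n := by positivity
    unfold glaserExponent; positivity
  have h := tsum_glaserCoeff hn0 (n - 2) hs
  rw [show n - 2 + 1 = n - 1 by omega] at h
  rw [← h]
  -- Each term of the Gamma series is a beta integral; the factor `(1-y)^m` comes from the shift by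
  -- `m` in the second parameter.
  have h1 : ∀ m : ℕ, ENNReal.ofReal (glaserCoeff n (n - 2) m * (Real.Gamma s *
      Real.Gamma (glaserExponent n (n - 2) + m) /
        Real.Gamma (s + (glaserExponent n (n - 2) + m)))) =
      ∫⁻ y in Set.Ioo (0 : ℝ) 1, ENNReal.ofReal (glaserCoeff n (n - 2) m) *
        ENNReal.ofReal (y ^ (s - 1) * (1 - y) ^ (glaserExponent n (n - 2) + m - 1)) := by
    intro m
    rw [lintegral_const_mul _ (by fun_prop), lintegral_beta hs (by positivity),
      ← ENNReal.ofReal_mul (glaserCoeff_nonneg _ _ _)]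
  simp_rw [h1]
  rw [← lintegral_tsum fun m => by fun_prop]
  refine setLIntegral_congr_fun measurableSet_Ioo fun y hy => ?_
  have hy0 : 0 < y := hy.1
  have hy1 : 0 < 1 - y := sub_pos.2 hy.2
  rw [← ENNReal.tsum_mul_left]
  refine tsum_congr fun m => ?_
  rw [← ENNReal.ofReal_mul (by positivity), ← ENNReal.ofReal_mul (glaserCoeff_nonneg _ _ _),
    show glaserExponent n (n - 2) + m - 1 = ((n : ℝ) - 3) / 2 + m by
      rw [glaserExponent_sub_two hn]; ring, Real.rpow_add hy1, Real.rpow_natCast, glaserD]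
  congr 1
  ring

/-- No estimate of the coefficients is needed: the Mellin transform at `s = 1` is finite, so the
series of nonnegative terms converges at almost every point of `(0, 1)`. Some such point `t` lies
below `y`, and its series dominates because `1 - y < 1 - t`. -/
theorem summable_glaserG {n : ℕ} (hn : 2 ≤ n) {y : ℝ} (hy : y ∈ Set.Ioo (0 : ℝ) 1) :
    Summable fun m => glaserD n m * (1 - y) ^ m := by
  have h := lintegral_glaser_tsum hn one_pos
  have hfin : ∀ᵐ t ∂(volume.restrict (Set.Ioo (0 : ℝ) 1)),
      ENNReal.ofReal (t ^ ((1 : ℝ) - 1) * (1 - t) ^ (((n : ℝ) - 3) / 2)) *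
        ∑' m, ENNReal.ofReal (glaserD n m * (1 - t) ^ m) < ⊤ := by
    refine ae_lt_top' ?_ (by rw [h]; exact ENNReal.ofReal_ne_top)
    exact Measurable.aemeasurable (.mul (by fun_prop) (.tsum fun m => by fun_prop))
  rw [ae_restrict_iff' measurableSet_Ioo] at hfin
  have hpos : volume (Set.Ioo 0 y) ≠ 0 := by
    simpa using hy.1
  obtain ⟨t, ht, htfin⟩ : ∃ t ∈ Set.Ioo 0 y, t ∈ Set.Ioo (0 : ℝ) 1 →
      ENNReal.ofReal (t ^ ((1 : ℝ) - 1) * (1 - t) ^ (((n : ℝ) - 3) / 2)) *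
        ∑' m, ENNReal.ofReal (glaserD n m * (1 - t) ^ m) < ⊤ := by
    by_contra hcon
    push Not at hcon
    refine hpos (measure_mono_null (fun t ht => ?_) hfin)
    have := hcon t ht
    simp only [Set.mem_compl_iff, Set.mem_ofPred_eq, Classical.not_imp, not_lt]
    exact this
  have ht1 : t < 1 := ht.2.trans hy.2
  have hlt := htfin ⟨ht.1, ht1⟩
  have hsum : ∑' m, ENNReal.ofReal (glaserD n m * (1 - t) ^ m) ≠ ⊤ := by
    intro htop
    rw [htop, ENNReal.mul_top] at hlt
    · exact lt_irrefl _ hlt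
    · have h1 : 0 < 1 - t := sub_pos.2 ht1
      have h0 : 0 < t := ht.1
      exact (ENNReal.ofReal_pos.2 (by positivity)).ne'
  have hs := ENNReal.summable_toReal hsum
  refine Summable.of_nonneg_of_le (fun m => ?_) (fun m => ?_) hs
  · have := glaserD_nonneg n m
    have h1 : 0 < 1 - y := sub_pos.2 hy.2
    positivity
  · have := glaserD_nonneg n m
    have h1 : 0 < 1 - t := sub_pos.2 ht1
    rw [ENNReal.toReal_ofReal (by positivity)]
    have h2 : 0 ≤ 1 - y := (sub_pos.2 hy.2).le
    have h3 : t < y := ht.2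
    gcongr

theorem glaserG_pos {n : ℕ} (hn : 2 ≤ n) {y : ℝ} (hy : y ∈ Set.Ioo (0 : ℝ) 1) :
    0 < glaserG n y := by
  have h1 : 0 < 1 - y := sub_pos.2 hy.2
  refine (summable_glaserG hn hy).tsum_pos (fun m => ?_) 0 ?_
  · have := glaserD_nonneg n m
    positivity
  · rw [pow_zero, mul_one]
    exact glaserCoeff_zero_pos (by omega) _

theorem measurable_glaserG (n : ℕ) : Measurable (glaserG n) := by
  unfold glaserG
  exact .tsum fun m => by fun_prop

/-- Up to the factor `y^(α-1)` and a constant, the density of `Y`. -/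
noncomputable def glaserWeight (n : ℕ) (y : ℝ) : ℝ :=
  (1 - y) ^ (((n : ℝ) - 3) / 2) * glaserG n y

@[fun_prop]
theorem measurable_glaserWeight (n : ℕ) : Measurable (glaserWeight n) := by
  have := measurable_glaserG n
  unfold glaserWeight
  fun_prop

theorem glaserWeight_pos {n : ℕ} (hn : 2 ≤ n) {y : ℝ} (hy : y ∈ Set.Ioo (0 : ℝ) 1) :
    0 < glaserWeight n y :=
  mul_pos (Real.rpow_pos_of_pos (sub_pos.2 hy.2) _) (glaserG_pos hn hy)

theorem lintegral_glaserWeight {n : ℕ} (hn : 2 ≤ n) {s : ℝ} (hs : 0 < s) :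
    ∫⁻ y in Set.Ioo (0 : ℝ) 1, ENNReal.ofReal (y ^ (s - 1) * glaserWeight n y) =
      ENNReal.ofReal (glaserMellin n (n - 1) s) := by
  rw [← lintegral_glaser_tsum hn hs]
  refine setLIntegral_congr_fun measurableSet_Ioo fun y hy => ?_
  have hy0 : 0 < y := hy.1
  have hy1 : 0 < 1 - y := sub_pos.2 hy.2
  rw [← ENNReal.ofReal_tsum_of_nonneg (fun m => mul_nonneg (glaserD_nonneg n m) (by positivity))
    (summable_glaserG hn hy), ← ENNReal.ofReal_mul (by positivity), glaserWeight, glaserG,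
    mul_assoc]

/-- The weight is integrable on `(0, 1)` by its Mellin transform at `1`, and `x⁻¹ ≤ y⁻¹` on `(y,
1)`. -/
theorem integrableOn_inv_mul_glaserWeight {n : ℕ} (hn : 2 ≤ n) {y : ℝ}
    (hy : y ∈ Set.Ioo (0 : ℝ) 1) :
    IntegrableOn (fun x => x⁻¹ * glaserWeight n x) (Set.Ioo y 1) := by
  have h1 : IntegrableOn (fun x : ℝ => x ^ ((1 : ℝ) - 1) * glaserWeight n x) (Set.Ioo 0 1) := by
    refine ⟨by fun_prop, ?_⟩
    rw [hasFiniteIntegral_iff_ofReal, lintegral_glaserWeight hn one_pos]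
    · exact ENNReal.ofReal_lt_top
    · exact ae_restrict_of_forall_mem measurableSet_Ioo fun x hx =>
        mul_nonneg (Real.rpow_nonneg hx.1.le _) (glaserWeight_pos hn hx).le
  have h2 := h1.mono_set (Set.Ioo_subset_Ioo_left hy.1.le)
  refine (h2.const_mul y⁻¹).mono' (by fun_prop) ?_
  refine ae_restrict_of_forall_mem measurableSet_Ioo fun x hx => ?_
  have hx0 : 0 < x := hy.1.trans hx.1
  have hw := glaserWeight_pos hn ⟨hx0, hx.2⟩
  rw [Real.norm_of_nonneg (by positivity), sub_self, Real.rpow_zero, one_mul]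
  have := hy.1
  have := hx.1
  gcongr

theorem intervalIntegrable_glaser {n : ℕ} (hn : 2 ≤ n) {y : ℝ} (hy : y ∈ Set.Ioo (0 : ℝ) 1) :
    IntervalIntegrable (fun x => x⁻¹ * (1 - x) ^ (((n : ℝ) - 3) / 2) * glaserG n x)
      volume y 1 := by
  rw [intervalIntegrable_iff_integrableOn_Ioo_of_le hy.2.le]
  refine (integrableOn_inv_mul_glaserWeight hn hy).congr_fun (fun x _ => ?_) measurableSet_Ioo
  simp only [glaserWeight, mul_assoc]

/-- The law of `Y`. -/
noncomputable def ratioMeasure (n : ℕ) (a : ℝ) : Measure ℝ :=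
  (volume.restrict (Set.Ioo (0 : ℝ) 1)).withDensity fun y =>
    ENNReal.ofReal ((glaserMellin n (n - 1) a)⁻¹ * (y ^ (a - 1) * glaserWeight n y))

theorem lintegral_ratioMeasure {n : ℕ} (hn : 2 ≤ n) {a : ℝ} (ha : 0 < a) {f : ℝ → ℝ}
    (hf : Measurable f) :
    ∫⁻ y, ENNReal.ofReal (f y) ∂(ratioMeasure n a) =
      ENNReal.ofReal (glaserMellin n (n - 1) a)⁻¹ *
        ∫⁻ y in Set.Ioo (0 : ℝ) 1, ENNReal.ofReal (y ^ (a - 1) * (glaserWeight n y * f y)) := by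
  have hM := glaserMellin_pos (by omega : n ≠ 0) (n - 1) ha
  rw [ratioMeasure, lintegral_withDensity_eq_lintegral_mul _ (by fun_prop) (by fun_prop),
    ← lintegral_const_mul _ (by fun_prop)]
  refine setLIntegral_congr_fun measurableSet_Ioo fun y hy => ?_
  have hy0 : 0 < y := hy.1
  have hw := glaserWeight_pos hn hy
  rw [Pi.mul_apply, ← ENNReal.ofReal_mul (by positivity), ← ENNReal.ofReal_mul (by positivity)]
  congr 1
  ring

theorem lintegral_pow_ratioMeasure {n : ℕ} (hn : 2 ≤ n) {a : ℝ} (ha : 0 < a) (k : ℕ) :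
    ∫⁻ y, ENNReal.ofReal (y ^ k) ∂(ratioMeasure n a) =
      ENNReal.ofReal (glaserMellin n (n - 1) (a + k) / glaserMellin n (n - 1) a) := by
  have hM := glaserMellin_pos (by omega : n ≠ 0) (n - 1) ha
  rw [lintegral_ratioMeasure hn ha (by fun_prop), div_eq_inv_mul,
    ENNReal.ofReal_mul (by positivity), ← lintegral_glaserWeight hn (by positivity : 0 < a + k)]
  congr 1
  refine setLIntegral_congr_fun measurableSet_Ioo fun y hy => ?_
  have hy0 : 0 < y := hy.1
  rw [show a + k - 1 = a - 1 + k by ring, Real.rpow_add hy0, Real.rpow_natCast]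
  congr 1
  ring

theorem isProbabilityMeasure_ratioMeasure {n : ℕ} (hn : 2 ≤ n) {a : ℝ} (ha : 0 < a) :
    IsProbabilityMeasure (ratioMeasure n a) := by
  have h := lintegral_pow_ratioMeasure hn ha 0
  simp only [pow_zero, ENNReal.ofReal_one, lintegral_const, one_mul, Nat.cast_zero, add_zero] at h
  rw [div_self (glaserMellin_pos (by omega) _ ha).ne', ENNReal.ofReal_one] at h
  exact ⟨h⟩

theorem ae_mem_Ioo_ratioMeasure (n : ℕ) (a : ℝ) :
    ∀ᵐ y ∂(ratioMeasure n a), y ∈ Set.Ioo (0 : ℝ) 1 :=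
  (withDensity_absolutelyContinuous _ _).ae_le (ae_restrict_mem measurableSet_Ioo)

theorem integral_pow_ratioMeasure {n : ℕ} (hn : 2 ≤ n) {a : ℝ} (ha : 0 < a) (k : ℕ) :
    ∫ y, y ^ k ∂(ratioMeasure n a) =
      glaserMellin n (n - 1) (a + k) / glaserMellin n (n - 1) a := by
  have hM := glaserMellin_pos (by omega : n ≠ 0) (n - 1) ha
  have hM' := glaserMellin_pos (by omega : n ≠ 0) (n - 1) (by positivity : 0 < a + k)
  rw [integral_eq_lintegral_of_nonneg_ae _ (by fun_prop), lintegral_pow_ratioMeasure hn ha,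
    ENNReal.toReal_ofReal (by positivity)]
  exact (ae_mem_Ioo_ratioMeasure n a).mono fun y hy => pow_nonneg hy.1.le k

theorem Real.Gamma_add_natCast_eq_mul_prod {x : ℝ} (hx : 0 < x) (m : ℕ) :
    Real.Gamma (x + m) = Real.Gamma x * ∏ i ∈ Finset.range m, (x + i) := by
  induction m with
  | zero => simp
  | succ m ih =>
    rw [Finset.prod_range_succ, Nat.cast_succ, ← add_assoc, Real.Gamma_add_one (by positivity), ih]
    ring

/-- An instance of the Gauss multiplication formula for integral shifts. -/
theorem glaserMellin_add_natCast {n : ℕ} (hn : 2 ≤ n) {a : ℝ} (ha : 0 < a) (k : ℕ) :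
    glaserMellin n (n - 1) (a + k) * Real.Gamma (n * (a + k)) / Real.Gamma (a + k) ^ n =
      (n : ℝ) ^ (n * k) *
        (glaserMellin n (n - 1) a * Real.Gamma (n * a) / Real.Gamma a ^ n) := by
  have hn' : (0 : ℝ) < n := by positivity
  induction k with
  | zero => simp
  | succ k ih =>
    set s := a + k with hs
    have hs0 : 0 < s := by positivity
    have e1 : a + (k + 1 : ℕ) = s + 1 := by rw [hs]; push_cast; ring
    rw [e1, mul_add n k, pow_add, mul_one, mul_comm ((n : ℝ) ^ (n * k)), mul_assoc, ← ih,
      Real.Gamma_add_one hs0.ne', mul_add (n : ℝ) s, mul_one,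
      Real.Gamma_add_natCast_eq_mul_prod (by positivity)]
    have hΓ := Real.Gamma_pos_of_pos hs0
    -- The functional equation of Gamma, in the numerator and the denominator of each factor.
    have h1 : glaserMellin n (n - 1) (s + 1) * ∏ k ∈ Finset.range (n - 1), (s + ((k : ℝ) + 1) / n)
        = glaserMellin n (n - 1) s * s ^ (n - 1) := by
      rw [glaserMellin, glaserMellin, ← Finset.prod_mul_distrib, ← Finset.card_range (n - 1),
        ← Finset.prod_const, Finset.card_range, ← Finset.prod_mul_distrib]
      refine Finset.prod_congr rfl fun i _ => ?_
      have hi : 0 < s + ((i : ℝ) + 1) / n := by positivity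
      have hΓi := Real.Gamma_pos_of_pos hi
      rw [add_right_comm s, Real.Gamma_add_one hs0.ne', Real.Gamma_add_one hi.ne']
      generalize s + ((i : ℝ) + 1) / n = z at hi hΓi ⊢
      field_simp
    -- The factor at `i = 0` is `n s`; the others are `n (s + i/n)` and cancel against the linear
    -- factors in `h1`.
    have h2 : ∏ i ∈ Finset.range n, ((n : ℝ) * s + i) =
        (n : ℝ) ^ n * s * ∏ k ∈ Finset.range (n - 1), (s + ((k : ℝ) + 1) / n) := by
      obtain ⟨m, rfl⟩ : ∃ m, n = m + 1 := ⟨n - 1, by omega⟩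
      rw [Finset.prod_range_succ', Nat.add_sub_cancel, pow_succ]
      have h3 : ∏ k ∈ Finset.range m, (((m + 1 : ℕ) : ℝ) * s + (k + 1 : ℕ)) =
          ((m + 1 : ℕ) : ℝ) ^ m *
            ∏ k ∈ Finset.range m, (s + ((k : ℝ) + 1) / (m + 1 : ℕ)) := by
        conv_rhs => rw [← Finset.card_range m, ← Finset.prod_const, Finset.card_range,
          ← Finset.prod_mul_distrib]
        refine Finset.prod_congr rfl fun i _ => ?_
        push_cast
        field_simp
      rw [h3]
      push_cast
      ring
    rw [h2, mul_pow]
    have hpow : s ^ n = s ^ (n - 1) * s := by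
      rw [← pow_succ, show n - 1 + 1 = n by omega]
    rw [div_eq_iff (by positivity)]
    calc _ = (glaserMellin n (n - 1) (s + 1) *
          ∏ k ∈ Finset.range (n - 1), (s + ((k : ℝ) + 1) / n)) *
            (Real.Gamma (n * s) * ((n : ℝ) ^ n * s)) := by ring
      _ = _ := by
        rw [h1, hpow]
        field_simp

theorem gammaMeasure_mul_isProbabilityMeasure {n : ℕ} (hn : n ≠ 0) (θ : GammaParam) :
    IsProbabilityMeasure (gammaMeasure (n * θ.shape) θ.rate) :=
  isProbabilityMeasure_gammaMeasure
    (mul_pos (Nat.cast_pos.2 (Nat.pos_of_ne_zero hn)) θ.shape_pos) θ.rate_pos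

/-- Here the bound is the `n`-th power of `t e^{-t} ≤ 1` at `t = X/n`, combined with `Y < 1`. -/
theorem ae_isStatisticRange_prod {n : ℕ} (hn : 2 ≤ n) (θ : GammaParam) :
    ∀ᵐ p ∂((gammaMeasure (n * θ.shape) θ.rate).prod (ratioMeasure n θ.shape)),
      IsStatisticRange n p := by
  have := gammaMeasure_mul_isProbabilityMeasure (by omega : n ≠ 0) θ
  have := isProbabilityMeasure_ratioMeasure hn θ.shape_pos
  have h1 : ∀ᵐ p ∂((gammaMeasure (n * θ.shape) θ.rate).prod (ratioMeasure n θ.shape)),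
      0 < p.1 := Measure.quasiMeasurePreserving_fst.ae (ae_pos_gammaMeasure _ _)
  have h2 : ∀ᵐ p ∂((gammaMeasure (n * θ.shape) θ.rate).prod (ratioMeasure n θ.shape)),
      p.2 ∈ Set.Ioo (0 : ℝ) 1 :=
    Measure.quasiMeasurePreserving_snd.ae (ae_mem_Ioo_ratioMeasure _ _)
  filter_upwards [h1, h2] with p hp1 hp2
  refine ⟨hp1, hp2.1.le, ?_⟩
  have hn' : (0 : ℝ) < n := by positivity
  have h3 : (p.1 / n) ^ n * Real.exp (-p.1) = (p.1 / n * Real.exp (-(p.1 / n))) ^ n := by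
    rw [mul_pow, ← Real.exp_nat_mul]
    congr 2
    field_simp
  have h4 : p.1 / n * Real.exp (-(p.1 / n)) ≤ 1 := by
    have h5 := Real.add_one_le_exp (p.1 / n)
    have h6 : p.1 / n * Real.exp (-(p.1 / n)) ≤
        Real.exp (p.1 / n) * Real.exp (-(p.1 / n)) := by gcongr; linarith
    rwa [← Real.exp_add, add_neg_cancel, Real.exp_zero] at h6
  rw [mul_assoc, h3]
  exact mul_le_one₀ hp2.2.le (by positivity) (pow_le_one₀ (by positivity) h4)

/-- The sum `X` and the mean ratio `Y` are independent; `X` has a gamma distribution, and `Y` has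
the density proportional to `y^(α-1) (1-y)^((n-3)/2) G(y)`. -/
theorem map_gammaStatistic {n : ℕ} (hn : 2 ≤ n) (θ : GammaParam) :
    (gammaSample n θ).map gammaStatistic =
      (gammaMeasure (n * θ.shape) θ.rate).prod (ratioMeasure n θ.shape) := by
  have hn0 : n ≠ 0 := by omega
  have hn' : (0 : ℝ) < n := by positivity
  have := gammaMeasure_mul_isProbabilityMeasure hn0 θ
  have := isProbabilityMeasure_ratioMeasure hn θ.shape_pos
  have := Measure.isProbabilityMeasure_map (μ := gammaSample n θ)
    (measurable_gammaStatistic n).aemeasurable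
  -- On the sample side a mixed moment is the `n`-th power of a moment of one observation; on the
  -- product side it splits into a moment of `X` and one of `Y`. Equating the two is exactly
  -- `glaserMellin_add_natCast`.
  refine Measure.ext_of_moments_toUnitSquare hn0 (ae_isStatisticRange_map_gammaStatistic hn0 θ)
    (ae_isStatisticRange_prod hn θ) fun j k => ?_
  rw [moments_gammaStatistic hn0]
  have h1 : ∀ p : ℝ × ℝ, (toUnitSquare n p).1 ^ j * (toUnitSquare n p).2 ^ k =
      (((n : ℝ) ^ (n * k))⁻¹ * (p.1 ^ (n * k) * Real.exp (-(((j : ℝ) + k) * p.1)))) *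
        p.2 ^ k := by
    intro p
    have : -(((j : ℝ) + k) * p.1) = j * (-p.1) + k * (-p.1) := by ring
    simp only [toUnitSquare]
    rw [this, Real.exp_add, Real.exp_nat_mul, Real.exp_nat_mul, pow_mul, pow_mul]
    rw [mul_pow, mul_pow, div_pow, div_pow]
    ring
  simp_rw [h1]
  obtain ⟨a, r, ha, hr⟩ := θ
  simp only
  rw [integral_prod_mul (fun x : ℝ => ((n : ℝ) ^ (n * k))⁻¹ *
      (x ^ (n * k) * Real.exp (-(((j : ℝ) + k) * x)))) (fun y : ℝ => y ^ k),
    integral_const_mul, integral_pow_mul_exp_gammaMeasure (by positivity) hr _ (by positivity),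
    integral_pow_ratioMeasure hn ha]
  have hM := glaserMellin_pos hn0 (n - 1) ha
  have hM' := glaserMellin_pos hn0 (n - 1) (by positivity : 0 < a + k)
  have hg := glaserMellin_add_natCast hn ha k
  have hΓ1 := Real.Gamma_pos_of_pos ha
  have hΓ2 := Real.Gamma_pos_of_pos (by positivity : 0 < a + k)
  have hΓ3 := Real.Gamma_pos_of_pos (by positivity : 0 < n * a)
  have hΓ4 := Real.Gamma_pos_of_pos (by positivity : 0 < n * (a + k))
  have e1 : (n : ℝ) * a + (n * k : ℕ) = n * (a + k) := by push_cast; ring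
  have hp : ∀ z b : ℝ, 0 < z → z ^ ((n : ℝ) * b) = (z ^ b) ^ n := fun z b hz => by
    rw [mul_comm, Real.rpow_mul hz.le, Real.rpow_natCast]
  rw [e1, hp r a hr, hp _ _ (by positivity), div_pow, mul_pow, mul_pow]
  generalize Real.Gamma (n * (a + k)) = G4 at *
  generalize Real.Gamma (n * a) = G3 at *
  generalize Real.Gamma (a + k) = G2 at *
  generalize Real.Gamma a = G1 at *
  generalize glaserMellin n (n - 1) (a + k) = M2 at *
  generalize glaserMellin n (n - 1) a = M1 at *
  have hR : 0 < r + ((j : ℝ) + k) := by positivity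
  generalize r + ((j : ℝ) + k) = R at *
  have hz : 0 < R ^ (a + k) := by positivity
  generalize R ^ (a + k) = z at *
  generalize r ^ a = w at *
  field_simp at hg ⊢
  linear_combination (-w ^ n) * hg

/-! ### Unbiasedness of `u₂(Y)` and `u₃(X, Y)` -/

/-- The variable is the lower limit of integration, so the oriented integral is treated as a
difference of integrals over the sections `(y, 1]` and `(1, y]` of two planar Borel sets. -/
theorem measurable_u2 (n : ℕ) : Measurable (u2 n) := by
  have hG := measurable_glaserG n
  have hm : Measurable fun x : ℝ => x⁻¹ * (1 - x) ^ (((n : ℝ) - 3) / 2) * glaserG n x := by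
    fun_prop
  have hI : ∀ s : Set (ℝ × ℝ), MeasurableSet s → Measurable fun y : ℝ =>
      ∫ x in Prod.mk y ⁻¹' s, x⁻¹ * (1 - x) ^ (((n : ℝ) - 3) / 2) * glaserG n x := by
    intro s hs
    simp_rw [← integral_indicator (measurable_prodMk_left hs)]
    exact (StronglyMeasurable.integral_prod_right (f := fun y x => s.indicator
      (fun p : ℝ × ℝ => p.2⁻¹ * (1 - p.2) ^ (((n : ℝ) - 3) / 2) * glaserG n p.2) (y, x))
      ((hm.comp measurable_snd).indicator hs).stronglyMeasurable).measurable
  have h1 := hI {p | p.1 < p.2 ∧ p.2 ≤ 1} ((measurableSet_lt measurable_fst measurable_snd).inter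
    (measurableSet_le measurable_snd measurable_const))
  have h2 := hI {p | 1 < p.2 ∧ p.2 ≤ p.1} ((measurableSet_lt measurable_const measurable_snd).inter
    (measurableSet_le measurable_snd measurable_fst))
  have h3 : Measurable fun y : ℝ =>
      ∫ x in y..1, x⁻¹ * (1 - x) ^ (((n : ℝ) - 3) / 2) * glaserG n x := h1.sub h2
  unfold u2
  fun_prop

/-- The prefactor of `u2` is the reciprocal of the weight, so it disappears from integrals against
the law of `Y`. -/
theorem glaserWeight_mul_u2 {n : ℕ} (hn : 2 ≤ n) {y : ℝ} (hy : y ∈ Set.Ioo (0 : ℝ) 1) :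
    glaserWeight n y * u2 n y = ∫ x in Set.Ioo y 1, x⁻¹ * glaserWeight n x := by
  have hG := glaserG_pos hn hy
  have h1 : 0 < 1 - y := sub_pos.2 hy.2
  have hp := Real.rpow_pos_of_pos h1 (((n : ℝ) - 3) / 2)
  rw [u2, intervalIntegral.integral_of_le hy.2.le, integral_Ioc_eq_integral_Ioo, neg_div,
    Real.rpow_neg h1.le]
  simp only [glaserWeight, mul_assoc]
  field_simp

theorem u2_nonneg {n : ℕ} (hn : 2 ≤ n) {y : ℝ} (hy : y ∈ Set.Ioo (0 : ℝ) 1) : 0 ≤ u2 n y := by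
  have h : 0 ≤ glaserWeight n y * u2 n y := by
    rw [glaserWeight_mul_u2 hn hy]
    exact setIntegral_nonneg measurableSet_Ioo fun x hx => mul_nonneg
      (inv_nonneg.2 (hy.1.trans hx.1).le) (glaserWeight_pos hn ⟨hy.1.trans hx.1, hx.2⟩).le
  exact nonneg_of_mul_nonneg_right h (glaserWeight_pos hn hy)

theorem lintegral_rpow_Ioo {a x : ℝ} (ha : 0 < a) (hx : 0 < x) :
    ∫⁻ y in Set.Ioo (0 : ℝ) x, ENNReal.ofReal (y ^ (a - 1)) = ENNReal.ofReal (x ^ a / a) := by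
  have hint : IntegrableOn (fun y : ℝ => y ^ (a - 1)) (Set.Ioo 0 x) :=
    (intervalIntegrable_iff_integrableOn_Ioo_of_le hx.le).1
      (intervalIntegral.intervalIntegrable_rpow' (by linarith))
  rw [← ofReal_integral_eq_lintegral_ofReal hint (ae_restrict_of_forall_mem measurableSet_Ioo
    fun y hy => Real.rpow_nonneg hy.1.le _), ← integral_Ioc_eq_integral_Ioo,
    ← intervalIntegral.integral_of_le hx.le, integral_rpow (Or.inl (by linarith)),
    sub_add_cancel, Real.zero_rpow ha.ne', sub_zero]

/-- Tonelli on the triangle `y < x`: the inner integral `∫_0^x y^(a-1) dy = x^a / a` turns `x⁻¹`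
into `x^(a-1)/a`, and what remains is the normalizing integral of the law divided by `a`. -/
theorem lintegral_u2_ratioMeasure {n : ℕ} (hn : 2 ≤ n) {a : ℝ} (ha : 0 < a) :
    ∫⁻ y, ENNReal.ofReal (u2 n y) ∂(ratioMeasure n a) = ENNReal.ofReal (1 / a) := by
  have hM := glaserMellin_pos (by omega : n ≠ 0) (n - 1) ha
  rw [lintegral_ratioMeasure hn ha (measurable_u2 n)]
  have h1 : ∀ y ∈ Set.Ioo (0 : ℝ) 1, ENNReal.ofReal (y ^ (a - 1) * (glaserWeight n y * u2 n y)) =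
      ∫⁻ x in Set.Ioo (0 : ℝ) 1, {p : ℝ × ℝ | p.1 < p.2}.indicator (fun p =>
        ENNReal.ofReal (p.1 ^ (a - 1)) * ENNReal.ofReal (p.2⁻¹ * glaserWeight n p.2)) (y, x) := by
    intro y hy
    have h2 : ∀ x ∈ Set.Ioo (0 : ℝ) 1, {p : ℝ × ℝ | p.1 < p.2}.indicator (fun p =>
        ENNReal.ofReal (p.1 ^ (a - 1)) * ENNReal.ofReal (p.2⁻¹ * glaserWeight n p.2)) (y, x) =
        (Set.Ioo y 1).indicator (fun x => ENNReal.ofReal (y ^ (a - 1)) *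
          ENNReal.ofReal (x⁻¹ * glaserWeight n x)) x := by
      intro x hx
      by_cases hxy : y < x
      · rw [Set.indicator_of_mem (by exact hxy), Set.indicator_of_mem (Set.mem_Ioo.2 ⟨hxy, hx.2⟩)]
      · rw [Set.indicator_of_notMem (by exact hxy), Set.indicator_of_notMem fun h => hxy h.1]
    rw [setLIntegral_congr_fun measurableSet_Ioo h2, setLIntegral_indicator measurableSet_Ioo,
      Set.inter_eq_left.2 (Set.Ioo_subset_Ioo_left hy.1.le), lintegral_const_mul _ (by fun_prop),
      ENNReal.ofReal_mul (Real.rpow_nonneg hy.1.le _), glaserWeight_mul_u2 hn hy,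
      ofReal_integral_eq_lintegral_ofReal (integrableOn_inv_mul_glaserWeight hn hy)]
    exact ae_restrict_of_forall_mem measurableSet_Ioo fun x hx => mul_nonneg
      (inv_nonneg.2 (hy.1.trans hx.1).le) (glaserWeight_pos hn ⟨hy.1.trans hx.1, hx.2⟩).le
  rw [setLIntegral_congr_fun measurableSet_Ioo h1, lintegral_lintegral_swap]
  · have h3 : ∀ x ∈ Set.Ioo (0 : ℝ) 1, ∫⁻ y in Set.Ioo (0 : ℝ) 1,
        {p : ℝ × ℝ | p.1 < p.2}.indicator (fun p => ENNReal.ofReal (p.1 ^ (a - 1)) *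
          ENNReal.ofReal (p.2⁻¹ * glaserWeight n p.2)) (y, x) =
        ENNReal.ofReal a⁻¹ * ENNReal.ofReal (x ^ (a - 1) * glaserWeight n x) := by
      intro x hx
      have hx0 : 0 < x := hx.1
      have hw := glaserWeight_pos hn hx
      have h2 : ∀ y ∈ Set.Ioo (0 : ℝ) 1, {p : ℝ × ℝ | p.1 < p.2}.indicator (fun p =>
          ENNReal.ofReal (p.1 ^ (a - 1)) * ENNReal.ofReal (p.2⁻¹ * glaserWeight n p.2)) (y, x) =
          (Set.Ioo 0 x).indicator (fun y => ENNReal.ofReal (y ^ (a - 1)) *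
            ENNReal.ofReal (x⁻¹ * glaserWeight n x)) y := by
        intro y hy
        by_cases hxy : y < x
        · rw [Set.indicator_of_mem (by exact hxy), Set.indicator_of_mem (Set.mem_Ioo.2 ⟨hy.1, hxy⟩)]
        · rw [Set.indicator_of_notMem (by exact hxy), Set.indicator_of_notMem fun h => hxy h.2]
      rw [setLIntegral_congr_fun measurableSet_Ioo h2, setLIntegral_indicator measurableSet_Ioo,
        Set.inter_eq_left.2 (Set.Ioo_subset_Ioo_right hx.2.le), lintegral_mul_const _ (by fun_prop),
        lintegral_rpow_Ioo ha hx0, ← ENNReal.ofReal_mul (by positivity),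
        ← ENNReal.ofReal_mul (by positivity), Real.rpow_sub_one hx0.ne']
      congr 1
      field_simp
    rw [setLIntegral_congr_fun measurableSet_Ioo h3, lintegral_const_mul _ (by fun_prop),
      lintegral_glaserWeight hn ha, ← ENNReal.ofReal_mul (by positivity),
      ← ENNReal.ofReal_mul (by positivity)]
    congr 1
    field_simp
  · refine Measurable.aemeasurable (Measurable.indicator ?_
      (measurableSet_lt measurable_fst measurable_snd))
    fun_prop

theorem integrable_u2_ratioMeasure {n : ℕ} (hn : 2 ≤ n) {a : ℝ} (ha : 0 < a) :
    Integrable (u2 n) (ratioMeasure n a) := by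
  refine ⟨(measurable_u2 n).aestronglyMeasurable, ?_⟩
  rw [hasFiniteIntegral_iff_ofReal
    ((ae_mem_Ioo_ratioMeasure n a).mono fun y hy => u2_nonneg hn hy),
    lintegral_u2_ratioMeasure hn ha]
  exact ENNReal.ofReal_lt_top

theorem integral_u2_ratioMeasure {n : ℕ} (hn : 2 ≤ n) {a : ℝ} (ha : 0 < a) :
    ∫ y, u2 n y ∂(ratioMeasure n a) = 1 / a := by
  rw [integral_eq_lintegral_of_nonneg_ae
    ((ae_mem_Ioo_ratioMeasure n a).mono fun y hy => u2_nonneg hn hy)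
    (measurable_u2 n).aestronglyMeasurable, lintegral_u2_ratioMeasure hn ha,
    ENNReal.toReal_ofReal (by positivity)]

theorem integral_id_gammaMeasure {a r : ℝ} (ha : 0 < a) (hr : 0 < r) :
    ∫ x, x ∂(gammaMeasure a r) = a / r := by
  have h := integral_pow_mul_exp_gammaMeasure ha hr 1 le_rfl
  simp only [pow_one, zero_mul, neg_zero, Real.exp_zero, mul_one, Nat.cast_one, add_zero] at h
  have hΓ := Real.Gamma_pos_of_pos ha
  rw [h, Real.Gamma_add_one ha.ne', Real.rpow_add_one hr.ne']
  field_simp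

theorem integrable_id_gammaMeasure {a r : ℝ} (ha : 0 < a) (hr : 0 < r) :
    Integrable (fun x => x) (gammaMeasure a r) := by
  refine not_imp_comm.1 integral_undef ?_
  rw [integral_id_gammaMeasure ha hr]
  positivity

/-- Integrals of products of a function of `X` and a function of `Y`. -/
theorem integral_gammaStatistic_mul {n : ℕ} (hn : 2 ≤ n) (θ : GammaParam) {f g : ℝ → ℝ}
    (hf : Measurable f) (hg : Measurable g)
    (hfi : Integrable f (gammaMeasure (n * θ.shape) θ.rate))
    (hgi : Integrable g (ratioMeasure n θ.shape)) :
    Integrable (fun x => f (sampleSum x) * g (meanRatio x)) (gammaSample n θ) ∧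
      ∫ x, f (sampleSum x) * g (meanRatio x) ∂(gammaSample n θ) =
        (∫ x, f x ∂(gammaMeasure (n * θ.shape) θ.rate)) * ∫ y, g y ∂(ratioMeasure n θ.shape) := by
  have := gammaMeasure_mul_isProbabilityMeasure (by omega : n ≠ 0) θ
  have := isProbabilityMeasure_ratioMeasure hn θ.shape_pos
  have hS := measurable_gammaStatistic n
  have hfg : Measurable fun p : ℝ × ℝ => f p.1 * g p.2 := by fun_prop
  constructor
  · refine (integrable_map_measure (f := gammaStatistic) (g := fun p : ℝ × ℝ => f p.1 * g p.2)
      hfg.aestronglyMeasurable hS.aemeasurable).1 ?_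
    rw [map_gammaStatistic hn]
    exact hfi.mul_prod hgi
  · rw [← integral_prod_mul, ← map_gammaStatistic hn, integral_map hS.aemeasurable
      hfg.aestronglyMeasurable]
    rfl

theorem isUnbiasedEstimator_shapeInvEstimator {n : ℕ} (hn : 2 ≤ n) :
    IsUnbiasedEstimator (gammaSample n) (fun θ => 1 / θ.shape) shapeInvEstimator := by
  intro θ
  have := gammaMeasure_mul_isProbabilityMeasure (by omega : n ≠ 0) θ
  have h := integral_gammaStatistic_mul hn θ (f := fun _ => 1) measurable_const (measurable_u2 n)
    (integrable_const _) (integrable_u2_ratioMeasure hn θ.shape_pos)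
  simp only [one_mul, integral_const, probReal_univ, smul_eq_mul,
    integral_u2_ratioMeasure hn θ.shape_pos] at h
  exact h

/-- By independence the expectation is `(α/λ) · (1/α)`. -/
theorem isUnbiasedEstimator_rateInvEstimator {n : ℕ} (hn : 2 ≤ n) :
    IsUnbiasedEstimator (gammaSample n) (fun θ => 1 / θ.rate) rateInvEstimator := by
  intro θ
  have hn' : (0 : ℝ) < n := by positivity
  have hs := θ.shape_pos
  have hr := θ.rate_pos
  have h := integral_gammaStatistic_mul hn θ (f := fun x => x / n) (by fun_prop) (measurable_u2 n)
    ((integrable_id_gammaMeasure (by positivity) hr).div_const _) (integrable_u2_ratioMeasure hn hs)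
  refine ⟨h.1, h.2.trans ?_⟩
  rw [integral_div, integral_id_gammaMeasure (by positivity) hr, integral_u2_ratioMeasure hn hs]
  field_simp

theorem isUMVUE_shapeInvEstimator {n : ℕ} (hn : 2 ≤ n) :
    IsUMVUE (gammaSample n) gammaStatistic (fun θ => 1 / θ.shape) shapeInvEstimator :=
  (hasFactoredDensity_gammaSample (by omega)).isUMVUE (measurable_gammaStatistic n)
    (isCompleteStatistic_gammaStatistic (by omega)) (isUnbiasedEstimator_shapeInvEstimator hn)
    (u := fun p => u2 n p.2) ((measurable_u2 n).comp measurable_snd)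
    fun _ => ae_of_all _ fun _ => rfl

theorem isUMVUE_rateInvEstimator {n : ℕ} (hn : 2 ≤ n) :
    IsUMVUE (gammaSample n) gammaStatistic (fun θ => 1 / θ.rate) rateInvEstimator :=
  (hasFactoredDensity_gammaSample (by omega)).isUMVUE (measurable_gammaStatistic n)
    (isCompleteStatistic_gammaStatistic (by omega)) (isUnbiasedEstimator_rateInvEstimator hn)
    (u := fun p => p.1 / n * u2 n p.2)
    ((measurable_fst.div_const _).mul ((measurable_u2 n).comp measurable_snd))
    fun _ => ae_of_all _ fun _ => rfl

/-! ### Samples of size two -/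

theorem glaserG_two (y : ℝ) : glaserG 2 y = 1 := by
  rw [glaserG, tsum_eq_single 0 fun m hm => by simp [glaserD, glaserCoeff, hm]]
  simp [glaserD, glaserCoeff]

theorem u2_two {y : ℝ} (hy : y ∈ Set.Ioc (0 : ℝ) 1) :
    u2 2 y = √(1 - y) * (2 * Real.log (1 + √(1 - y)) - Real.log y) := by
  rcases hy.2.eq_or_lt with rfl | hy1
  · simp [u2]
  have hy' : y ∈ Set.Ioo (0 : ℝ) 1 := ⟨hy.1, hy1⟩
  have hint := intervalIntegrable_glaser le_rfl hy'
  have e1 : ((2 : ℕ) : ℝ) = 2 := by norm_num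
  have e2 : -((2 : ℝ) - 3) / 2 = 1 / 2 := by norm_num
  -- The antiderivative of `x⁻¹ (1-x)^(-1/2)` chosen here is continuous up to `x = 1` and vanishes
  -- there. It is differentiated only in the open interval, since the integrand is singular at `1`.
  have h := intervalIntegral.integral_eq_sub_of_hasDerivAt_of_le
    (f := fun x => Real.log x - 2 * Real.log (1 + √(1 - x))) hy.2 ?_ (fun x hx => ?_) hint
  · rw [u2, h, glaserG_two, e1, e2, ← Real.sqrt_eq_rpow]
    simp
  · intro x hx
    have hx0 : x ≠ 0 := (hy.1.trans_le hx.1).ne'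
    have hs : 1 + √(1 - x) ≠ 0 := by positivity
    refine ContinuousAt.continuousWithinAt ?_
    fun_prop (disch := assumption)
  · have hx0 : 0 < x := hy.1.trans hx.1
    have hx1 : 0 < 1 - x := sub_pos.2 hx.2
    set r := √(1 - x) with hr
    have hr0 : 0 < r := Real.sqrt_pos.2 hx1
    have hrr : r ^ 2 = 1 - x := Real.sq_sqrt hx1.le
    have h1 : HasDerivAt (fun x : ℝ => √(1 - x)) (-1 / (2 * r)) x :=
      ((hasDerivAt_id x).const_sub 1).sqrt hx1.ne'
    have h2 := (Real.hasDerivAt_log hx0.ne').sub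
      (((h1.const_add 1).log (by positivity : 1 + √(1 - x) ≠ 0)).const_mul 2)
    refine h2.congr_deriv ?_
    rw [glaserG_two, e1, show ((2 : ℝ) - 3) / 2 = -(1 / 2) by norm_num, Real.rpow_neg hx1.le,
      ← Real.sqrt_eq_rpow, ← hr]
    have hx2 : x = 1 - r ^ 2 := by rw [hrr]; ring
    field_simp
    rw [hx2]
    ring

/-- By symmetry let `a ≤ b`. Then the root is `(b-a)/(a+b)`, one plus the root is `2b/(a+b)`, and
the logarithms collapse to `log (4b²/(4ab)) = log b - log a`. -/
theorem sqrt_mul_log_eq {a b : ℝ} (ha : 0 < a) (hb : 0 < b) :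
    √(1 - 4 * a * b / (a + b) ^ 2) * (2 * Real.log (1 + √(1 - 4 * a * b / (a + b) ^ 2)) -
      Real.log (4 * a * b / (a + b) ^ 2)) = kernelT2 a b := by
  wlog hab : a ≤ b generalizing a b
  · have h := this hb ha (not_le.1 hab).le
    rw [show 4 * a * b = 4 * b * a by ring, add_comm a b, h, kernelT2, kernelT2, add_comm a b]
    ring
  have h1 : 1 - 4 * a * b / (a + b) ^ 2 = ((b - a) / (a + b)) ^ 2 := by
    field_simp
    ring
  have h2 : 1 + (b - a) / (a + b) = 2 * b / (a + b) := by
    field_simp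
    ring
  rw [h1, Real.sqrt_sq (div_nonneg (sub_nonneg.2 hab) (by positivity)), h2, kernelT2,
    Real.log_div (by positivity) (by positivity), Real.log_div (by positivity) (by positivity),
    Real.log_mul (by positivity) (by positivity), Real.log_mul (by positivity) (by positivity),
    Real.log_mul (by positivity) (by positivity), Real.log_pow,
    show (4 : ℝ) = 2 ^ 2 by norm_num, Real.log_pow]
  push_cast
  ring

theorem shapeInvEstimator_two {x : Fin 2 → ℝ} (hx : ∀ i, 0 < x i) :
    shapeInvEstimator x = kernelT2 (x 0) (x 1) := by
  have h0 := hx 0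
  have h1 := hx 1
  have hY : meanRatio x = 4 * x 0 * x 1 / (x 0 + x 1) ^ 2 := by
    simp only [meanRatio, sampleMean, sampleSum, Fin.prod_univ_two, Fin.sum_univ_two]
    push_cast
    field_simp
    norm_num
  have hmem : meanRatio x ∈ Set.Ioc (0 : ℝ) 1 := by
    rw [hY]
    refine ⟨by positivity, ?_⟩
    rw [div_le_one (by positivity)]
    nlinarith [sq_nonneg (x 0 - x 1)]
  rw [shapeInvEstimator, u2_two hmem, hY, sqrt_mul_log_eq h0 h1]

theorem rateInvEstimator_two {x : Fin 2 → ℝ} (hx : ∀ i, 0 < x i) :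
    rateInvEstimator x = kernelT3 (x 0) (x 1) := by
  have h0 := hx 0
  have h1 := hx 1
  have h := shapeInvEstimator_two hx
  rw [shapeInvEstimator] at h
  rw [rateInvEstimator, h, kernelT2, kernelT3, sampleMean, sampleSum, Fin.sum_univ_two]
  push_cast
  field_simp

theorem yeChenShapeInv_two {x : Fin 2 → ℝ} (hx : ∀ i, 0 < x i) :
    yeChenShapeInv x = kernelT2 (x 0) (x 1) := by
  have h0 := hx 0
  have h1 := hx 1
  simp only [yeChenShapeInv, kernelT2, sampleMean, sampleSum, Fin.sum_univ_two]
  push_cast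
  field_simp
  ring

/-! ### The `U`-statistics -/

/-- The sum of a symmetric function that vanishes on the diagonal is twice the sum over the pairs
`i < j`. -/
theorem Finset.sum_sum_eq_two_mul_sum_Ioi {n : ℕ} {f : Fin n → Fin n → ℝ}
    (hsymm : ∀ i j, f i j = f j i) (hdiag : ∀ i, f i i = 0) :
    ∑ i, ∑ j, f i j = 2 * ∑ i, ∑ j ∈ Finset.Ioi i, f i j := by
  have h1 : ∀ i, ∑ j, f i j = ∑ j ∈ Finset.Ioi i, f i j + ∑ j ∈ Finset.Iio i, f i j := by
    intro i
    rw [← Finset.sum_filter_add_sum_filter_not Finset.univ (fun j => i < j)]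
    congr 1
    · exact Finset.sum_congr (by ext; simp) fun _ _ => rfl
    · refine (Finset.sum_subset (fun j => by simpa using le_of_lt) fun j hj hj' => ?_).symm
      have : j = i := le_antisymm (by simpa using hj) (by simpa using hj')
      rw [this, hdiag]
  have h2 : ∑ i, ∑ j ∈ Finset.Iio i, f i j = ∑ i, ∑ j ∈ Finset.Ioi i, f i j := by
    rw [Finset.sum_comm' (t' := Finset.univ) (s' := fun j => Finset.Ioi j) (by simp)]
    exact Finset.sum_congr rfl fun i _ => Finset.sum_congr rfl fun j _ => hsymm j i
  simp_rw [h1]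
  rw [Finset.sum_add_distrib, h2, two_mul]

/-- Expand the kernel and sum over all ordered pairs: the terms `xᵢ log xᵢ` are each counted `n`
times, and the mixed terms form the product `(∑ xᵢ)(∑ log xᵢ)`. The kernel is symmetric and zero on
the diagonal, so half of this is the sum over `i < j`. -/
theorem uStatistic_kernelT3 {n : ℕ} (hn : 2 ≤ n) (x : Fin n → ℝ) :
    uStatistic kernelT3 x = yeChenRateInv x := by
  have hn' : (0 : ℝ) < n := by positivity
  have hn1 : (0 : ℝ) < n - 1 := by
    have : (2 : ℝ) ≤ n := by exact_mod_cast hn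
    linarith
  have h := Finset.sum_sum_eq_two_mul_sum_Ioi (f := fun i j => kernelT3 (x i) (x j))
    (fun i j => by simp only [kernelT3]; ring) (fun i => by simp [kernelT3])
  have h2 : ∑ i, ∑ j, kernelT3 (x i) (x j) =
      n * ∑ i, x i * Real.log (x i) - (∑ i, x i) * ∑ i, Real.log (x i) := by
    have h3 : ∀ i j, kernelT3 (x i) (x j) = 1 / 2 * (x j * Real.log (x j)) +
        1 / 2 * (x i * Real.log (x i)) - (1 / 2 * (x i * Real.log (x j)) +
          1 / 2 * (x j * Real.log (x i))) := fun i j => by rw [kernelT3]; ring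
    simp_rw [h3, Finset.sum_sub_distrib, Finset.sum_add_distrib, ← Finset.mul_sum,
      ← Finset.sum_mul, Finset.sum_const, Finset.card_univ, Fintype.card_fin, nsmul_eq_mul]
    simp only [← mul_assoc, mul_comm (n : ℝ), ← Finset.sum_mul]
    rw [← Finset.mul_sum]
    ring
  rw [uStatistic, yeChenRateInv, sampleMean, sampleSum]
  rw [h2] at h
  rw [show ∑ i, ∑ j ∈ Finset.Ioi i, kernelT3 (x i) (x j) =
    (n * ∑ i, x i * Real.log (x i) - (∑ i, x i) * ∑ i, Real.log (x i)) / 2 by linarith]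
  field_simp

theorem yeChenShapeInv_eq {n : ℕ} (x : Fin n → ℝ) :
    yeChenRateInv x / sampleMean x = yeChenShapeInv x :=
  mul_div_assoc _ _ _

/-- Two distinct observations form a sample of size two. -/
theorem measurePreserving_pair {n : ℕ} (θ : GammaParam) {i j : Fin n} (hij : i ≠ j) :
    MeasurePreserving (fun x : Fin n → ℝ => ![x i, x j]) (gammaSample n θ) (gammaSample 2 θ) := by
  have hind : IndepFun (fun x : Fin n → ℝ => x i) (fun x => x j) (gammaSample n θ) :=
    (iIndepFun_pi (X := fun _ : Fin n => (id : ℝ → ℝ)) fun _ => aemeasurable_id).indepFun hij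
  have hpair : MeasurePreserving (fun x : Fin n → ℝ => (x i, x j)) (gammaSample n θ)
      ((gammaMeasure θ.shape θ.rate).prod (gammaMeasure θ.shape θ.rate)) := by
    refine ⟨by fun_prop, ?_⟩
    rw [(indepFun_iff_map_prod_eq_prod_map_map (measurable_pi_apply i).aemeasurable
      (measurable_pi_apply j).aemeasurable).1 hind]
    have h : ∀ k : Fin n, Measure.map (fun x : Fin n → ℝ => x k) (gammaSample n θ) =
        gammaMeasure θ.shape θ.rate := fun k =>
      (measurePreserving_eval (fun _ : Fin n => gammaMeasure θ.shape θ.rate) k).map_eq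
    rw [h, h]
  exact ((measurePreserving_finTwoArrow (gammaMeasure θ.shape θ.rate)).symm).comp hpair

/-- The `U`-statistic inherits unbiasedness from its kernel. -/
theorem isUnbiasedEstimator_uStatistic {n : ℕ} (hn : 2 ≤ n) {h : GammaParam → ℝ}
    {T : (Fin 2 → ℝ) → ℝ} (hT : IsUnbiasedEstimator (gammaSample 2) h T) {k : ℝ → ℝ → ℝ}
    (hk : ∀ x : Fin 2 → ℝ, (∀ i, 0 < x i) → T x = k (x 0) (x 1)) :
    IsUnbiasedEstimator (gammaSample n) h (uStatistic k) := by
  intro θ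
  have hT' : Integrable (fun x : Fin 2 → ℝ => k (x 0) (x 1)) (gammaSample 2 θ) ∧
      ∫ x : Fin 2 → ℝ, k (x 0) (x 1) ∂(gammaSample 2 θ) = h θ := by
    have hae : T =ᵐ[gammaSample 2 θ] fun x => k (x 0) (x 1) := (ae_pos_gammaSample 2 θ).mono hk
    exact ⟨(hT θ).1.congr hae, by rw [← integral_congr_ae hae, (hT θ).2]⟩
  have hpair : ∀ i j : Fin n, i ≠ j → Integrable (fun x => k (x i) (x j)) (gammaSample n θ) ∧
      ∫ x, k (x i) (x j) ∂(gammaSample n θ) = h θ := by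
    intro i j hij
    have hmp := measurePreserving_pair θ hij
    refine ⟨hmp.integrable_comp_of_integrable hT'.1, ?_⟩
    rw [← hT'.2, ← hmp.map_eq, integral_map hmp.aemeasurable (by rw [hmp.map_eq]; exact hT'.1.1)]
    rfl
  have hij : ∀ i : Fin n, ∀ j ∈ Finset.Ioi i, i ≠ j := fun i j hj => (Finset.mem_Ioi.1 hj).ne
  have hin : ∀ i : Fin n, Integrable (fun x => ∑ j ∈ Finset.Ioi i, k (x i) (x j))
      (gammaSample n θ) := fun i =>
    integrable_finsetSum _ fun j hj => (hpair i j (hij i j hj)).1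
  refine ⟨(integrable_finsetSum _ fun i _ => hin i).const_mul _, ?_⟩
  have hn' : (0 : ℝ) < n := by positivity
  have hn1 : (0 : ℝ) < n - 1 := by
    have : (2 : ℝ) ≤ n := by exact_mod_cast hn
    linarith
  -- The pairs `i < j` are counted by symmetrization, applied to the function that is constant off
  -- the diagonal and zero on it.
  have hcount : ∑ i : Fin n, ∑ _j ∈ Finset.Ioi i, h θ = n * (n - 1) / 2 * h θ := by
    have h1 := Finset.sum_sum_eq_two_mul_sum_Ioi (n := n)
      (f := fun i j => if i = j then 0 else h θ) (fun i j => by simp only [eq_comm]) (by simp)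
    have h2 : ∀ i : Fin n, ∑ j ∈ Finset.Ioi i, (if i = j then 0 else h θ) =
        ∑ _j ∈ Finset.Ioi i, h θ := fun i =>
      Finset.sum_congr rfl fun j hj => if_neg (hij i j hj)
    have h3 : ∀ i j : Fin n, (if i = j then 0 else h θ) = h θ - if i = j then h θ else 0 := by
      intro i j; split_ifs <;> ring
    simp_rw [h2, h3, Finset.sum_sub_distrib] at h1
    simp only [Finset.sum_const, Finset.card_univ, Fintype.card_fin, nsmul_eq_mul,
      Finset.sum_ite_eq, Finset.mem_univ, if_true] at h1 ⊢
    linarith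
  unfold uStatistic
  rw [integral_const_mul, integral_finsetSum _ fun i _ => hin i]
  have hinner : ∀ i : Fin n, ∫ x, ∑ j ∈ Finset.Ioi i, k (x i) (x j) ∂(gammaSample n θ) =
      ∑ _j ∈ Finset.Ioi i, h θ := fun i => by
    rw [integral_finsetSum _ fun j hj => (hpair i j (hij i j hj)).1]
    exact Finset.sum_congr rfl fun j hj => (hpair i j (hij i j hj)).2
  simp_rw [hinner]
  rw [hcount]
  field_simp

theorem mainTheorem3 :
    -- for every sample size `n ≥ 2`: `u₂` is well defined on `(0, 1)`, and `u₂(Y)` and `u₃(X, Y)`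
    -- are the UMVUEs of `1/α` and `1/λ`
    (∀ n : ℕ, 2 ≤ n →
      (∀ y ∈ Set.Ioo (0 : ℝ) 1,
        Summable (fun m => glaserD n m * (1 - y) ^ m) ∧ 0 < glaserG n y ∧
        IntervalIntegrable (fun x => x⁻¹ * (1 - x) ^ (((n : ℝ) - 3) / 2) * glaserG n x)
          MeasureTheory.volume y 1) ∧
      IsUMVUE (gammaSample n) gammaStatistic (fun θ => 1 / θ.shape) shapeInvEstimator ∧
      IsUMVUE (gammaSample n) gammaStatistic (fun θ => 1 / θ.rate) rateInvEstimator) ∧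
    -- closed forms for `n = 2`
    (∀ y ∈ Set.Ioc (0 : ℝ) 1,
      u2 2 y = √(1 - y) * (2 * Real.log (1 + √(1 - y)) - Real.log y)) ∧
    (∀ x : Fin 2 → ℝ, (∀ i, 0 < x i) →
      shapeInvEstimator x = kernelT2 (x 0) (x 1) ∧
      rateInvEstimator x = kernelT3 (x 0) (x 1) ∧
      shapeInvEstimator x = yeChenShapeInv x) ∧
    -- the kernels generate closed-form estimators for every sample size `n ≥ 2`
    (∀ n : ℕ, 2 ≤ n →
      (∀ x : Fin n → ℝ, (∀ i, 0 < x i) →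
        uStatistic kernelT3 x = yeChenRateInv x ∧
        uStatistic kernelT3 x / sampleMean x = yeChenShapeInv x) ∧
      IsUnbiasedEstimator (gammaSample n) (fun θ => 1 / θ.rate) (uStatistic kernelT3) ∧
      IsUnbiasedEstimator (gammaSample n) (fun θ => 1 / θ.shape) (uStatistic kernelT2)) := by
  refine ⟨fun n hn => ⟨fun y hy => ⟨summable_glaserG hn hy, glaserG_pos hn hy,
    intervalIntegrable_glaser hn hy⟩, isUMVUE_shapeInvEstimator hn, isUMVUE_rateInvEstimator hn⟩,
    fun y hy => u2_two hy, fun x hx => ⟨shapeInvEstimator_two hx, rateInvEstimator_two hx,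
      (shapeInvEstimator_two hx).trans (yeChenShapeInv_two hx).symm⟩,
    fun n hn => ⟨fun x _ => ⟨uStatistic_kernelT3 hn x, ?_⟩, ?_, ?_⟩⟩
  · rw [uStatistic_kernelT3 hn, yeChenShapeInv_eq]
  · exact isUnbiasedEstimator_uStatistic hn (isUnbiasedEstimator_rateInvEstimator le_rfl)
      fun x hx => rateInvEstimator_two hx
  · exact isUnbiasedEstimator_uStatistic hn (isUnbiasedEstimator_shapeInvEstimator le_rfl)
      fun x hx => shapeInvEstimator_two hx
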